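/- **Setting.** Let $\mathbb E_n$ be the space of positive definite symmetric real $n\times n$ matrices with the $\mathrm{GL}(n,\mathbb R)$-invariant Riemannian metric $ds^2=\operatorname{tr}(dX\,X^{-1}\,dX\,X^{-1})$, and let $\mathbb{PE}_n$ be the space of positive definite matrices up to a positive scalar factor, identified with $\{X\in\mathbb E_n:\det X=1\}$ with the induced metric. Write $\rho$ for the Riemannian distance of either space. A *geodesic* means a nonconstant complete directed geodesic $\nu$, considered up to orientation-preserving affine changes of parameter $t\mapsto at+b$, $a>0$. For a point $X$ and a geodesic $\nu$ put $\operatorname{dist}(X,\nu)=\inf_{s\in\mathbb R}\rho(X,\nu(s))$. Say that $\nu$ is *directed as* $\mu$ if for every $s_0\in\mathbb R$ one has $\operatorname{dist}(\mu(t),\nu)=\inf_{s\ge s_0}\rho(\mu(t),\nu(s))$ for all sufficiently large $t$. For a geodesic $\mu$: * the *finite pencil* $\Pi^{fin}_\mu$ is the set of all geodesics $\nu$ directed as $\mu$ for which the finite limit $\lim_{t\to+\infty}\operatorname{dist}(\mu(t),\nu)$ exists; * the *null pencil* $\Pi^{nul}_\mu$ is the set of all geodesics $\nu$ directed as $\mu$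 for which $\lim_{t\to+\infty}\operatorname{dist}(\mu(t),\nu)=0$. **Theorem 3.3.** Let $\alpha_1,\dots,\alpha_m$ be positive integers with sum $n$, let $\psi_1>\psi_2>\dots>\psi_m$ be real numbers, let $E_\alpha$ be the $\alpha\times\alpha$ unit matrix, and let $$\gamma(t)=\operatorname{diag}\bigl(e^{\psi_1t}E_{\alpha_1},\,e^{\psi_2t}E_{\alpha_2},\,\dots,\,e^{\psi_mt}E_{\alpha_m}\bigr),$$ considered either in $\mathbb E_n$ or (up to scalar factors) in $\mathbb{PE}_n$, where it is assumed to be nonconstant in the space in question (in $\mathbb E_n$: some $\psi_k\neq0$; in $\mathbb{PE}_n$: $m>1$). Then in each of the two spaces: a) The finite pencil $\Pi^{fin}_\gamma$ consists of exactly the geodesics that can be represented in the form $h\gamma(t)h^\top$ (up to scalar factors in the case of $\mathbb{PE}_n$), where $h$ ranges over the invertible $(\alpha_1+\alpha_2+\cdots)\times(\alpha_1+\alpha_2+\cdots)$ block triangular matrices $$h=\begin{pmatrix}H_{11}&H_{12}&H_{13}&\dots\\0&H_{22}&H_{23}&\dots\\0&0&H_{33}&\dots\\\vdots&\vdots&\vdots&\ddots\end{pmatrix}.$$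 b) The null pencil $\Pi^{nul}_\gamma$ consists of exactly the geodesics that can be represented in this form with all diagonal blocks equal to unit matrices, $H_{kk}=E_{\alpha_k}$. -/

import Mathlib

open Filter Topology
open scoped Matrix ContDiff

noncomputable section

namespace SymPencil

/-! Matrices are real and indexed by an arbitrary finite type `ι`, so that "size `n`" is the
cardinality of `ι`.  Derivatives of matrix-valued functions are taken entry by entry. -/

variable {ι : Type*} [Fintype ι] [DecidableEq ι]

/-- The space `𝔼` of positive definite symmetric real matrices. -/
def EE (ι : Type*) [Fintype ι] [DecidableEq ι] : Set (Matrix ι ι ℝ) :=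
  {X | X.PosDef}

/-- The space `ℙ𝔼` of positive definite matrices up to a positive factor; each class is
represented by its unique element of determinant `1`. -/
def PEE (ι : Type*) [Fintype ι] [DecidableEq ι] : Set (Matrix ι ι ℝ) :=
  {X | X.PosDef ∧ X.det = 1}

/-- The projection `𝔼 → ℙ𝔼`: the representative of determinant `1` of the class of `X`. -/
def toPEE (X : Matrix ι ι ℝ) : Matrix ι ι ℝ :=
  (X.det ^ (-(1 / (Fintype.card ι : ℝ)))) • X

/-- The entrywise derivative of a curve of matrices. -/
def velocity (c : ℝ → Matrix ι ι ℝ) (t : ℝ) : Matrix ι ι ℝ :=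
  Matrix.of fun i j => deriv (fun s => c s i j) t

/-- The Riemannian metric `ds² = tr (dX · X⁻¹ · dX · X⁻¹)` on `𝔼`, polarized. On `ℙ𝔼`, the induced
metric is used. -/
def metric (X V W : Matrix ι ι ℝ) : ℝ :=
  (V * X⁻¹ * W * X⁻¹).trace

/-- The length of the curve `c` on `[0, 1]`. -/
def length (c : ℝ → Matrix ι ι ℝ) : ℝ :=
  ∫ t in (0 : ℝ)..1, √(metric (c t) (velocity c t) (velocity c t))

/-- The Riemannian distance `ρ(X, Y)` in the submanifold `S` of `𝔼`: the infimum of the lengths of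
the `C¹` curves in `S` that go from `X` to `Y`. -/
def rho (S : Set (Matrix ι ι ℝ)) (X Y : Matrix ι ι ℝ) : ℝ :=
  sInf {l | ∃ c : ℝ → Matrix ι ι ℝ, (∀ i j, ContDiff ℝ 1 fun t => c t i j) ∧
    (∀ t ∈ Set.Icc (0 : ℝ) 1, c t ∈ S) ∧ c 0 = X ∧ c 1 = Y ∧ l = length c}

/-- The tangent vectors at `X` to the submanifold `S`: the velocities at `X` of curves in `S`. -/
def tangentTo (S : Set (Matrix ι ι ℝ)) (X : Matrix ι ι ℝ) : Set (Matrix ι ι ℝ) :=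
  {W | ∃ c : ℝ → Matrix ι ι ℝ, c 0 = X ∧ (∀ᶠ s in 𝓝 (0 : ℝ), c s ∈ S) ∧
    ∀ i j, HasDerivAt (fun s => c s i j) (W i j) 0}

/-- (Nonconstant, complete, parametrized) geodesics of the submanifold `S` of `𝔼` with the induced
metric `g`. The last field is the geodesic equation, i.e. the Euler–Lagrange equation of the energy
`½ ∫ g(μ', μ')`, tested against the tangent vectors `W` of `S`:
`d/dt g(μ', W) = ½ (D_W g)(μ', μ')`, where `W` is constant along `μ` on the left; in terms of the
Levi-Civita connection of `𝔼` it says that `∇_{μ'} μ'` is orthogonal to `S`. The direction of the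
geodesic is that of increasing parameter. -/
structure IsGeodesic (S : Set (Matrix ι ι ℝ)) (μ : ℝ → Matrix ι ι ℝ) : Prop where
  smooth : ∀ i j, ContDiff ℝ ∞ fun t => μ t i j
  mem : ∀ t, μ t ∈ S
  nonconstant : ∃ s t, μ s ≠ μ t
  equation : ∀ t, ∀ W ∈ tangentTo S (μ t),
    deriv (fun s => metric (μ s) (velocity μ s) W) t =
      1 / 2 * deriv (fun ε : ℝ => metric (μ t + ε • W) (velocity μ t) (velocity μ t)) 0

/-- Two parametrized geodesics are the same directed geodesic: one is obtained from the other by an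
orientation-preserving affine change of the parameter. -/
def SameDirected (ν μ : ℝ → Matrix ι ι ℝ) : Prop :=
  ∃ a b : ℝ, 0 < a ∧ ∀ t, ν t = μ (a * t + b)

/-- The distance `dist(X, ν)` from a point to a geodesic. -/
def distTo (S : Set (Matrix ι ι ℝ)) (X : Matrix ι ι ℝ) (ν : ℝ → Matrix ι ι ℝ) : ℝ :=
  ⨅ s : ℝ, rho S X (ν s)

/-- The direction of `ν` agrees with that of `μ`: as `μ(t)` runs to the positive end of `μ`, its
distance to `ν` is realized arbitrarily far in the positive direction of `ν`. (A geodesic run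
backwards is another directed geodesic, although it has the same points.) -/
def CoDirected (S : Set (Matrix ι ι ℝ)) (μ ν : ℝ → Matrix ι ι ℝ) : Prop :=
  ∀ s₀ : ℝ, ∀ᶠ t in atTop, distTo S (μ t) ν = ⨅ s : Set.Ici s₀, rho S (μ t) (ν s)

/-- The finite pencil of `μ`: all the directed geodesics `ν`, directed as `μ`, for which
`dist(μ(t), ν)` has a finite limit as `t → +∞`. -/
def finitePencil (S : Set (Matrix ι ι ℝ)) (μ : ℝ → Matrix ι ι ℝ) : Set (ℝ → Matrix ι ι ℝ) :=
  {ν | IsGeodesic S ν ∧ CoDirected S μ ν ∧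
    ∃ L : ℝ, Tendsto (fun t => distTo S (μ t) ν) atTop (𝓝 L)}

/-- The null pencil of `μ`: all the directed geodesics `ν`, directed as `μ`, for which
`dist(μ(t), ν) → 0` as `t → +∞`. -/
def nullPencil (S : Set (Matrix ι ι ℝ)) (μ : ℝ → Matrix ι ι ℝ) : Set (ℝ → Matrix ι ι ℝ) :=
  {ν | IsGeodesic S ν ∧ CoDirected S μ ν ∧
    Tendsto (fun t => distTo S (μ t) ν) atTop (𝓝 0)}

/-- The index set of the rows of an `(α₁ + ⋯ + αₘ) × (α₁ + ⋯ + αₘ)` block matrix: the pairs of a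
block number and a position in the block. -/
abbrev Idx {m : ℕ} (α : Fin m → ℕ) : Type := (k : Fin m) × Fin (α k)

/-- `γ(t)`, the block diagonal matrix with the blocks `exp (ψₖ t) E` of sizes `αₖ`. -/
def gam {m : ℕ} (α : Fin m → ℕ) (ψ : Fin m → ℝ) (t : ℝ) : Matrix (Idx α) (Idx α) ℝ :=
  Matrix.diagonal fun i => Real.exp (ψ i.1 * t)

/-- The group of the invertible block upper triangular matrices: the blocks `H k l` with `l < k`
vanish (`k` is the block row, `l` the block column). -/
def blockTri {m : ℕ} (α : Fin m → ℕ) : Set (Matrix (Idx α) (Idx α) ℝ) :=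
  {h | IsUnit h.det ∧ ∀ i j : Idx α, j.1 < i.1 → h i j = 0}

/-- The group of the block unipotent upper triangular matrices: moreover, the diagonal blocks are
unit matrices. -/
def blockUni {m : ℕ} (α : Fin m → ℕ) : Set (Matrix (Idx α) (Idx α) ℝ) :=
  {h | (∀ i j : Idx α, j.1 < i.1 → h i j = 0) ∧ ∀ k, h.blockDiag' k = 1}

end SymPencil

end

open SymPencil

/-! A curve in either space is a geodesic iff it has the form `k exp(tΛ) kᵀ` with `Λ` diagonal
(of trace `0` in `ℙ𝔼`). Let `h` be block triangular with block diagonal part `D`. Conjugation by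
`exp(-tΛ/2)`, where `γ(t) = exp(tΛ)`, moves `h` to `D` as `t → ∞`, so `h γ hᵀ` is asymptotic to
`D γ Dᵀ`. As `D` commutes with `γ`, the distance from `γ(t)` to `D γ Dᵀ` does not depend on `t`;
hence the distance from `γ(t)` to `h γ hᵀ` tends to the distance from `1` to `D γ Dᵀ`.

Conversely, `X ↦ log (vᵀ X v)` is `1`-Lipschitz for every `v ≠ 0`, so two geodesics at bounded
distance have the same exponential growth rates along every `v`. For `v` a standard basis vector
this makes `k` block triangular, up to a reparametrization and a permutation of the exponents.
If the limit distance is `0`, then `D γ Dᵀ` passes through `1`, so it is a shift of `γ`, and `h`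
may be replaced by `h D⁻¹`. -/

namespace SymPencil

open Matrix Set Real

section Congruence

variable {ι : Type*} {X : Matrix ι ι ℝ}

theorem isSymm_of_posDef (hX : X.PosDef) : X.IsSymm := isHermitian_iff_isSymm.1 hX.isHermitian

variable [Fintype ι]

theorem dotProduct_pos (hX : X.PosDef) {v : ι → ℝ} (hv : v ≠ 0) : 0 < v ⬝ᵥ X *ᵥ v := by
  simpa using hX.dotProduct_mulVec_pos hv

theorem dotProduct_congr (g B : Matrix ι ι ℝ) (v : ι → ℝ) :
    v ⬝ᵥ (g * B * gᵀ) *ᵥ v = (gᵀ *ᵥ v) ⬝ᵥ B *ᵥ (gᵀ *ᵥ v) := by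
  rw [← mulVec_mulVec, ← mulVec_mulVec, dotProduct_mulVec, mulVec_transpose g v]

open scoped MatrixOrder in
theorem exists_mul_transpose (hX : X.PosDef) : ∃ g : Matrix ι ι ℝ, X = g * gᵀ := by
  classical
  obtain ⟨y, hy⟩ := CStarAlgebra.nonneg_iff_eq_star_mul_self.1 hX.posSemidef.nonneg
  exact ⟨yᵀ, by simpa [star_eq_conjTranspose, conjTranspose_eq_transpose_of_trivial] using hy⟩

variable [DecidableEq ι] {h k V : Matrix ι ι ℝ}

theorem transpose_mul_inv_transpose (hh : IsUnit h.det) : hᵀ * h⁻¹ᵀ = 1 := by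
  rw [← transpose_mul, nonsing_inv_mul _ hh, transpose_one]

theorem congr_inv_congr (hh : IsUnit h.det) (X : Matrix ι ι ℝ) :
    h⁻¹ * (h * X * hᵀ) * h⁻¹ᵀ = X := by
  calc h⁻¹ * (h * X * hᵀ) * h⁻¹ᵀ = (h⁻¹ * h) * X * (hᵀ * h⁻¹ᵀ) := by simp only [Matrix.mul_assoc]
    _ = X := by
      rw [nonsing_inv_mul _ hh, transpose_mul_inv_transpose hh, Matrix.one_mul, Matrix.mul_one]

theorem congr_congr_inv (hh : IsUnit h.det) (X : Matrix ι ι ℝ) :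
    h * (h⁻¹ * X * h⁻¹ᵀ) * hᵀ = X := by
  simpa only [nonsing_inv_nonsing_inv _ hh]
    using congr_inv_congr (isUnit_nonsing_inv_det _ hh) X

theorem inv_congr (h X : Matrix ι ι ℝ) : (h * X * hᵀ)⁻¹ = h⁻¹ᵀ * X⁻¹ * h⁻¹ := by
  rw [Matrix.mul_inv_rev, Matrix.mul_inv_rev, transpose_nonsing_inv, Matrix.mul_assoc]

theorem congr_mul_inv_congr (hh : IsUnit h.det) (V X : Matrix ι ι ℝ) :
    (h * V * hᵀ) * (h * X * hᵀ)⁻¹ = h * (V * X⁻¹) * h⁻¹ := by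
  rw [inv_congr]
  calc (h * V * hᵀ) * (h⁻¹ᵀ * X⁻¹ * h⁻¹) = h * V * (hᵀ * h⁻¹ᵀ) * X⁻¹ * h⁻¹ := by
        simp only [Matrix.mul_assoc]
    _ = h * (V * X⁻¹) * h⁻¹ := by
        rw [transpose_mul_inv_transpose hh, Matrix.mul_one, Matrix.mul_assoc h]

theorem posDef_congr (hh : IsUnit h.det) (hX : X.PosDef) : (h * X * hᵀ).PosDef := by
  simpa only [star_eq_conjTranspose, conjTranspose_eq_transpose_of_trivial] using
    (IsUnit.posDef_star_right_conjugate_iff ((isUnit_iff_isUnit_det _).2 hh)).2 hX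

theorem isUnit_det_of_posDef_mul_transpose (h : (k * kᵀ).PosDef) : IsUnit k.det := by
  have := h.det_pos.ne'
  rw [det_mul] at this
  exact (left_ne_zero_of_mul this).isUnit

theorem exists_orthogonal_diagonal (hV : V.IsSymm) :
    ∃ (O : Matrix ι ι ℝ) (l : ι → ℝ), O * Oᵀ = 1 ∧ V = O * diagonal l * Oᵀ := by
  have hH : V.IsHermitian := isHermitian_iff_isSymm.2 hV
  refine ⟨hH.eigenvectorUnitary, hH.eigenvalues, ?_, ?_⟩
  · simpa only [star_eq_conjTranspose, conjTranspose_eq_transpose_of_trivial] using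
      Unitary.mul_star_self_of_mem hH.eigenvectorUnitary.2
  · exact hH.spectral_theorem.trans (by
      rw [Unitary.conjStarAlgAut_apply, star_eq_conjTranspose,
        conjTranspose_eq_transpose_of_trivial]; rfl)

theorem exists_simultaneous_diagonal (hX : X.PosDef) (hV : V.IsSymm) :
    ∃ (k : Matrix ι ι ℝ) (l : ι → ℝ),
      IsUnit k.det ∧ X = k * kᵀ ∧ V = k * diagonal l * kᵀ := by
  obtain ⟨g, rfl⟩ := exists_mul_transpose hX
  have hg := isUnit_det_of_posDef_mul_transpose hX
  have hB : (g⁻¹ * V * g⁻¹ᵀ).IsSymm := by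
    simp only [IsSymm, transpose_mul, transpose_transpose, hV.eq, Matrix.mul_assoc]
  obtain ⟨O, l, hO, hl⟩ := exists_orthogonal_diagonal hB
  refine ⟨g * O, l, ?_, ?_, ?_⟩
  · rw [det_mul]
    exact hg.mul (isUnit_det_of_right_inverse hO)
  · rw [transpose_mul, Matrix.mul_assoc g, ← Matrix.mul_assoc O, hO, Matrix.one_mul]
  · rw [← congr_congr_inv hg V, hl, transpose_mul]
    simp only [Matrix.mul_assoc]

theorem trace_inv_mul_congr (hk : IsUnit k.det) (V : Matrix ι ι ℝ) :
    ((k * kᵀ)⁻¹ * (k * V * kᵀ)).trace = V.trace := by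
  have := congr_mul_inv_congr hk V 1
  rw [Matrix.mul_one, inv_one, Matrix.mul_one] at this
  rw [trace_mul_comm, this, trace_mul_comm, ← Matrix.mul_assoc, nonsing_inv_mul _ hk,
    Matrix.one_mul]

end Congruence

section Metric

variable {ι : Type*} [Fintype ι] [DecidableEq ι] {h k X V : Matrix ι ι ℝ}

theorem metric_congr (hh : IsUnit h.det) (X V W : Matrix ι ι ℝ) :
    metric (h * X * hᵀ) (h * V * hᵀ) (h * W * hᵀ) = metric X V W := by
  unfold metric
  rw [Matrix.mul_assoc (h * V * hᵀ * _), congr_mul_inv_congr hh, congr_mul_inv_congr hh]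
  calc (h * (V * X⁻¹) * h⁻¹ * (h * (W * X⁻¹) * h⁻¹)).trace
      = (h * ((V * X⁻¹) * ((h⁻¹ * h) * (W * X⁻¹))) * h⁻¹).trace := by simp only [Matrix.mul_assoc]
    _ = (V * X⁻¹ * W * X⁻¹).trace := by
        rw [trace_mul_comm, ← Matrix.mul_assoc, nonsing_inv_mul _ hh]
        simp only [Matrix.one_mul, Matrix.mul_assoc]

theorem metric_comm (X V W : Matrix ι ι ℝ) : metric X V W = metric X W V := by
  unfold metric
  rw [Matrix.mul_assoc, trace_mul_comm, ← Matrix.mul_assoc]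

theorem metric_smul (X V : Matrix ι ι ℝ) (a : ℝ) :
    metric X (a • V) (a • V) = a ^ 2 * metric X V V := by
  simp only [metric, smul_mul_assoc, mul_smul_comm, trace_smul, smul_eq_mul]
  ring

theorem metric_congr_diagonal (hk : IsUnit k.det) (l : ι → ℝ) :
    metric (k * kᵀ) (k * diagonal l * kᵀ) (k * diagonal l * kᵀ) = ∑ i, l i ^ 2 := by
  have := metric_congr hk 1 (diagonal l) (diagonal l)
  rw [Matrix.mul_one] at this
  rw [this]
  simp [metric, sq]

theorem metric_self_nonneg (hX : X.PosDef) (hV : V.IsSymm) : 0 ≤ metric X V V := by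
  obtain ⟨k, l, hk, rfl, rfl⟩ := exists_simultaneous_diagonal hX hV
  rw [metric_congr_diagonal hk]
  positivity

theorem eq_zero_of_metric_self (hX : X.PosDef) (hV : V.IsSymm) (h : metric X V V = 0) :
    V = 0 := by
  obtain ⟨k, l, hk, rfl, rfl⟩ := exists_simultaneous_diagonal hX hV
  rw [metric_congr_diagonal hk, Finset.sum_eq_zero_iff_of_nonneg fun i _ => sq_nonneg (l i)] at h
  have hl : l = 0 := funext fun i => pow_eq_zero_iff two_ne_zero |>.1 (h i (Finset.mem_univ _))
  rw [hl, Pi.zero_def, diagonal_zero, Matrix.mul_zero, Matrix.zero_mul]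

theorem sq_dotProduct_le_metric (hX : X.PosDef) (hV : V.IsSymm) (v : ι → ℝ) :
    (v ⬝ᵥ V *ᵥ v) ^ 2 ≤ (v ⬝ᵥ X *ᵥ v) ^ 2 * metric X V V := by
  obtain ⟨k, l, hk, rfl, rfl⟩ := exists_simultaneous_diagonal hX hV
  set w := kᵀ *ᵥ v with hw
  have hXv : v ⬝ᵥ (k * kᵀ) *ᵥ v = ∑ i, w i ^ 2 := by
    simpa [dotProduct, sq] using dotProduct_congr k 1 v
  have hVv : v ⬝ᵥ (k * diagonal l * kᵀ) *ᵥ v = ∑ i, w i ^ 2 * l i := by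
    rw [dotProduct_congr, ← hw]
    simp only [dotProduct, mulVec_diagonal]
    exact Finset.sum_congr rfl fun i _ => by ring
  rw [metric_congr_diagonal hk, hXv, hVv]
  calc (∑ i, w i ^ 2 * l i) ^ 2 ≤ (∑ i, (w i ^ 2) ^ 2) * ∑ i, l i ^ 2 :=
        Finset.sum_mul_sq_le_sq_mul_sq _ _ _
    _ ≤ (∑ i, w i ^ 2) ^ 2 * ∑ i, l i ^ 2 := by
        gcongr
        exact Finset.sum_sq_le_sq_sum_of_nonneg fun i _ => sq_nonneg _

end Metric

section Slice

variable {ι : Type*} [Fintype ι] [DecidableEq ι] {p : Prop} {g h k X : Matrix ι ι ℝ}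

/-- The positive definite matrices, normalized to determinant `1` if `p` holds. This treats `𝔼`
(`p = False`) and `ℙ𝔼` (`p = True`) simultaneously. -/
def slice (p : Prop) (ι : Type*) [Fintype ι] [DecidableEq ι] : Set (Matrix ι ι ℝ) :=
  {X | X.PosDef ∧ (p → X.det = 1)}

theorem EE_eq_slice : EE ι = slice False ι := by simp [EE, slice]

theorem PEE_eq_slice : PEE ι = slice True ι := by simp [PEE, slice]

/-- The matrices that act on `slice p ι` by congruence. -/
structure Preserves (p : Prop) (h : Matrix ι ι ℝ) : Prop where
  isUnit : IsUnit h.det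
  det_sq : p → h.det ^ 2 = 1

theorem Preserves.inv (hh : Preserves p h) : Preserves p h⁻¹ where
  isUnit := isUnit_nonsing_inv_det h hh.isUnit
  det_sq hp := by rw [det_nonsing_inv, Ring.inverse_eq_inv', inv_pow, hh.det_sq hp, inv_one]

theorem Preserves.mul (hg : Preserves p g) (hh : Preserves p h) : Preserves p (g * h) where
  isUnit := by simpa only [det_mul] using hg.isUnit.mul hh.isUnit
  det_sq hp := by rw [det_mul, mul_pow, hg.det_sq hp, hh.det_sq hp, one_mul]

theorem congr_mem_slice (hh : Preserves p h) (hX : X ∈ slice p ι) : h * X * hᵀ ∈ slice p ι := by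
  refine ⟨posDef_congr hh.isUnit hX.1, fun hp => ?_⟩
  rw [det_mul, det_mul, det_transpose, hX.2 hp, mul_one, ← sq, hh.det_sq hp]

theorem mul_transpose_mem_slice (hk : Preserves p k) : k * kᵀ ∈ slice p ι := by
  simpa using congr_mem_slice hk ⟨PosDef.one, fun _ => det_one⟩

theorem preserves_of_mul_transpose_mem (h : k * kᵀ ∈ slice p ι) : Preserves p k where
  isUnit := isUnit_det_of_posDef_mul_transpose h.1
  det_sq hp := by simpa only [det_mul, det_transpose, ← sq] using h.2 hp

end Slice

section ExpDiag

variable {ι : Type*} [DecidableEq ι]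

/-- The diagonal matrix `exp(t · diag l)`. -/
noncomputable def expDiag (l : ι → ℝ) (t : ℝ) : Matrix ι ι ℝ :=
  diagonal fun i => exp (l i * t)

theorem expDiag_zero (l : ι → ℝ) : expDiag l 0 = 1 := by simp [expDiag]

theorem transpose_expDiag (l : ι → ℝ) (t : ℝ) : (expDiag l t)ᵀ = expDiag l t :=
  diagonal_transpose _

variable [Fintype ι]

theorem expDiag_add (l : ι → ℝ) (s t : ℝ) : expDiag l (s + t) = expDiag l s * expDiag l t := by
  simp only [expDiag, diagonal_mul_diagonal, mul_add, exp_add]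

theorem expDiag_mul_expDiag_neg (l : ι → ℝ) (t : ℝ) : expDiag l t * expDiag l (-t) = 1 := by
  rw [← expDiag_add, add_neg_cancel, expDiag_zero]

theorem commute_diagonal_expDiag (l : ι → ℝ) (t : ℝ) : Commute (diagonal l) (expDiag l t) :=
  commute_diagonal _ _

theorem det_expDiag (l : ι → ℝ) (t : ℝ) : (expDiag l t).det = exp ((∑ i, l i) * t) := by
  rw [expDiag, det_diagonal, ← exp_sum, Finset.sum_mul]

theorem preserves_expDiag {p : Prop} {l : ι → ℝ} (hl : p → ∑ i, l i = 0) (t : ℝ) :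
    Preserves p (expDiag l t) where
  isUnit := by
    rw [det_expDiag]
    exact (exp_pos _).ne'.isUnit
  det_sq hp := by simp [det_expDiag, hl hp]

/-- The curve `k exp(t · diag l) kᵀ`; these curves are the geodesics of `𝔼`. -/
noncomputable def expCurve (k : Matrix ι ι ℝ) (l : ι → ℝ) (t : ℝ) : Matrix ι ι ℝ :=
  k * expDiag l t * kᵀ

theorem expCurve_zero (k : Matrix ι ι ℝ) (l : ι → ℝ) : expCurve k l 0 = k * kᵀ := by
  rw [expCurve, expDiag_zero, Matrix.mul_one]

theorem expCurve_mul (h k : Matrix ι ι ℝ) (l : ι → ℝ) (t : ℝ) :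
    expCurve (h * k) l t = h * expCurve k l t * hᵀ := by
  simp only [expCurve, transpose_mul, Matrix.mul_assoc]

theorem expCurve_add (k : Matrix ι ι ℝ) (l : ι → ℝ) (s t : ℝ) :
    expCurve k l (s + t) = expCurve (k * expDiag l (s / 2)) l t := by
  have h : s + t = s / 2 + t + s / 2 := by ring
  simp only [expCurve, transpose_mul, transpose_expDiag, h, expDiag_add, Matrix.mul_assoc]

theorem expCurve_eq_mul_transpose (k : Matrix ι ι ℝ) (l : ι → ℝ) (t : ℝ) :
    expCurve k l t = (k * expDiag l (t / 2)) * (k * expDiag l (t / 2))ᵀ := by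
  simpa only [add_zero, expCurve_zero] using expCurve_add k l t 0

theorem expCurve_mem {p : Prop} {k : Matrix ι ι ℝ} {l : ι → ℝ} (hk : Preserves p k)
    (hl : p → ∑ i, l i = 0) (t : ℝ) : expCurve k l t ∈ slice p ι := by
  rw [expCurve_eq_mul_transpose]
  exact mul_transpose_mem_slice (hk.mul (preserves_expDiag hl _))

theorem exists_expCurve {p : Prop} {X Y : Matrix ι ι ℝ} (hX : X ∈ slice p ι)
    (hY : Y ∈ slice p ι) :
    ∃ (k : Matrix ι ι ℝ) (l : ι → ℝ), Preserves p k ∧ (p → ∑ i, l i = 0) ∧ X = k * kᵀ ∧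
      Y = expCurve k l 1 := by
  obtain ⟨k, d, hk, rfl, rfl⟩ := exists_simultaneous_diagonal hX.1 (isSymm_of_posDef hY.1)
  have hp := preserves_of_mul_transpose_mem hX
  have hd : diagonal d ∈ slice p ι := by
    simpa only [congr_inv_congr hk] using congr_mem_slice hp.inv hY
  have hpos : ∀ i, 0 < d i := posDef_diagonal_iff.1 hd.1
  refine ⟨k, fun i => log (d i), hp, fun h => ?_, rfl, ?_⟩
  · have hdet := hd.2 h
    rw [det_diagonal] at hdet
    rw [← log_prod fun i _ => (hpos i).ne', hdet, log_one]
  · simp only [expCurve, expDiag, mul_one, exp_log (hpos _)]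

end ExpDiag

section Calculus

open scoped Matrix.Norms.Operator

variable {ι : Type*} {c : ℝ → Matrix ι ι ℝ} {V : Matrix ι ι ℝ} {t : ℝ}

theorem isSymm_velocity (h : ∀ᶠ s in 𝓝 t, (c s).PosDef) : (velocity c t).IsSymm := by
  ext i j
  refine Filter.EventuallyEq.deriv_eq ?_
  filter_upwards [h] with s hs using (isSymm_of_posDef hs).apply i j

theorem hasDerivAt_matrix [Finite ι] :
    HasDerivAt c V t ↔ ∀ i j, HasDerivAt (fun s => c s i j) (V i j) t := by
  have := Fintype.ofFinite ι
  exact hasDerivAt_pi.trans (forall_congr' fun _ => hasDerivAt_pi)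

theorem velocity_eq_of_hasDerivAt [Finite ι] (h : HasDerivAt c V t) : velocity c t = V := by
  ext i j
  exact (hasDerivAt_matrix.1 h i j).deriv

variable [Fintype ι]

theorem contDiff_matrix {n : WithTop ℕ∞} :
    ContDiff ℝ n c ↔ ∀ i j, ContDiff ℝ n fun t => c t i j :=
  let e : Matrix ι ι ℝ ≃L[ℝ] ι → ι → ℝ := (ofLinearEquiv ℝ).symm.toContinuousLinearEquiv
  e.comp_contDiff_iff.symm.trans (contDiff_pi.trans (forall_congr' fun _ => contDiff_pi))

theorem hasDerivAt_velocity {n : WithTop ℕ∞} (hc : ContDiff ℝ n c) (hn : n ≠ 0) (t : ℝ) :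
    HasDerivAt c (velocity c t) t :=
  hasDerivAt_matrix.2 fun i j =>
    ((contDiff_matrix.1 hc i j).differentiable hn t).hasDerivAt

theorem continuous_velocity (hc : ContDiff ℝ 1 c) : Continuous (velocity c) :=
  continuous_matrix fun i j => (contDiff_matrix.1 hc i j).continuous_deriv le_rfl

theorem hasDerivAt_trace (hc : HasDerivAt c V t) :
    HasDerivAt (fun s => (c s).trace) V.trace t :=
  HasDerivAt.fun_sum fun i _ => hasDerivAt_matrix.1 hc i i

theorem hasDerivAt_dotProduct (hc : HasDerivAt c V t) (v : ι → ℝ) :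
    HasDerivAt (fun s => v ⬝ᵥ c s *ᵥ v) (v ⬝ᵥ V *ᵥ v) t :=
  HasDerivAt.fun_sum fun i _ => (HasDerivAt.fun_sum fun j _ =>
    (hasDerivAt_matrix.1 hc i j).mul_const (v j)).const_mul (v i)

variable [DecidableEq ι]

theorem hasDerivAt_inv (hc : HasDerivAt c V t) (h : IsUnit (c t).det) :
    HasDerivAt (fun s => (c s)⁻¹) (-((c t)⁻¹ * V * (c t)⁻¹)) t := by
  obtain ⟨u, hu⟩ := (isUnit_iff_isUnit_det _).2 h
  have : CompleteSpace (Matrix ι ι ℝ) := FiniteDimensional.complete ℝ _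
  have hinv := hasFDerivAt_ringInverse (𝕜 := ℝ) u
  rw [hu] at hinv
  have hcomp : HasDerivAt (fun s => Ring.inverse (c s)) _ t := hinv.comp_hasDerivAt t hc
  rw [funext fun s => nonsing_inv_eq_ringInverse (c s), ← hu, ← coe_units_inv]
  simpa only [_root_.neg_apply, ContinuousLinearMap.mulLeftRight_apply] using hcomp

theorem contDiff_expDiag (l : ι → ℝ) (n : WithTop ℕ∞) : ContDiff ℝ n (expDiag l) := by
  refine contDiff_matrix.2 fun i j => ?_
  simp only [expDiag, diagonal_apply]
  split_ifs <;> fun_prop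

theorem hasDerivAt_expDiag (l : ι → ℝ) (t : ℝ) :
    HasDerivAt (expDiag l) (diagonal l * expDiag l t) t := by
  refine hasDerivAt_matrix.2 fun i j => ?_
  simp only [expDiag, diagonal_mul_diagonal, diagonal_apply]
  split_ifs
  · simpa [mul_comm] using ((hasDerivAt_id t).const_mul (l i)).exp
  · exact hasDerivAt_const t 0

theorem contDiff_expCurve (k : Matrix ι ι ℝ) (l : ι → ℝ) (n : WithTop ℕ∞) :
    ContDiff ℝ n (expCurve k l) :=
  (contDiff_const.mul (contDiff_expDiag l n)).mul contDiff_const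

theorem hasDerivAt_expCurve' (k : Matrix ι ι ℝ) (l : ι → ℝ) (t : ℝ) :
    HasDerivAt (expCurve k l) (k * (diagonal l * expDiag l t) * kᵀ) t :=
  ((hasDerivAt_expDiag l t).const_mul k).mul_const kᵀ

theorem hasDerivAt_expCurve {k : Matrix ι ι ℝ} (hk : IsUnit k.det) (l : ι → ℝ) (t : ℝ) :
    HasDerivAt (expCurve k l) (k * diagonal l * k⁻¹ * expCurve k l t) t := by
  convert hasDerivAt_expCurve' k l t using 1
  rw [expCurve, Matrix.mul_assoc k, Matrix.mul_assoc k, Matrix.mul_assoc (diagonal l),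
    ← Matrix.mul_assoc k⁻¹, ← Matrix.mul_assoc k⁻¹, nonsing_inv_mul _ hk]
  simp only [Matrix.one_mul, Matrix.mul_assoc]

theorem velocity_expCurve (k : Matrix ι ι ℝ) (l : ι → ℝ) (t : ℝ) :
    velocity (expCurve k l) t =
      (k * expDiag l (t / 2)) * diagonal l * (k * expDiag l (t / 2))ᵀ := by
  rw [velocity_eq_of_hasDerivAt (hasDerivAt_expCurve' k l t), transpose_mul,
    transpose_expDiag, ← add_halves t, expDiag_add, add_halves, Matrix.mul_assoc k (expDiag l _),
    ← (commute_diagonal_expDiag l _).eq]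
  simp only [Matrix.mul_assoc]

end Calculus

section Length

open scoped Matrix.Norms.Operator

variable {ι : Type*} [Fintype ι] [DecidableEq ι] {c d : ℝ → Matrix ι ι ℝ} {t : ℝ}

/-- The Riemannian speed of a curve, that is, the integrand of `length`. -/
noncomputable def speed (c : ℝ → Matrix ι ι ℝ) (t : ℝ) : ℝ :=
  √(metric (c t) (velocity c t) (velocity c t))

theorem speed_nonneg (c : ℝ → Matrix ι ι ℝ) (t : ℝ) : 0 ≤ speed c t := sqrt_nonneg _

theorem length_nonneg (c : ℝ → Matrix ι ι ℝ) : 0 ≤ length c :=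
  intervalIntegral.integral_nonneg zero_le_one fun t _ => speed_nonneg c t

theorem continuousOn_speed (hc : ContDiff ℝ 1 c) {s : Set ℝ} (hs : ∀ t ∈ s, (c t).PosDef) :
    ContinuousOn (speed c) s := by
  have hv := (continuous_velocity hc).continuousOn (s := s)
  have hinv : ContinuousOn (fun t => (c t)⁻¹) s := fun t ht =>
    (hasDerivAt_inv (hasDerivAt_velocity hc one_ne_zero t)
      (hs t ht).det_pos.ne'.isUnit).continuousAt.continuousWithinAt
  exact continuous_sqrt.comp_continuousOn <|
    continuous_id.matrix_trace.comp_continuousOn (((hv.mul hinv).mul hv).mul hinv)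

theorem speed_congr (h : c =ᶠ[𝓝 t] d) : speed c t = speed d t := by
  have hv : velocity c t = velocity d t := by
    ext i j
    exact Filter.EventuallyEq.deriv_eq (h.mono fun s hs => congrFun (congrFun hs i) j)
  rw [speed, speed, hv, h.eq_of_nhds]

theorem speed_congr_const {h : Matrix ι ι ℝ} (hh : IsUnit h.det) (hc : ContDiff ℝ 1 c) (t : ℝ) :
    speed (fun s => h * c s * hᵀ) t = speed c t := by
  have hd := ((hasDerivAt_velocity hc one_ne_zero t).const_mul h).mul_const hᵀ
  rw [speed, velocity_eq_of_hasDerivAt hd, metric_congr hh, speed]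

theorem speed_comp (hc : ContDiff ℝ 1 c) {f : ℝ → ℝ} {a : ℝ} (hf : HasDerivAt f a t) :
    speed (c ∘ f) t = |a| * speed c (f t) := by
  have hd := (hasDerivAt_velocity hc one_ne_zero (f t)).scomp t hf
  rw [speed, velocity_eq_of_hasDerivAt hd, Function.comp_apply, metric_smul,
    sqrt_mul (sq_nonneg a), sqrt_sq_eq_abs, speed]

theorem length_expCurve {k : Matrix ι ι ℝ} (hk : IsUnit k.det) (l : ι → ℝ) :
    length (expCurve k l) = √(∑ i, l i ^ 2) := by
  have h (t : ℝ) : IsUnit (k * expDiag l (t / 2)).det := by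
    rw [det_mul, det_expDiag]
    exact hk.mul (exp_pos _).ne'.isUnit
  simp only [length, velocity_expCurve, expCurve_eq_mul_transpose, metric_congr_diagonal (h _),
    intervalIntegral.integral_const, sub_zero, one_smul]

theorem integral_speed_comp (hc : ContDiff ℝ 1 c) (hpos : ∀ t ∈ Icc (0 : ℝ) 1, (c t).PosDef)
    {f : ℝ → ℝ} (hf : ContDiff ℝ 1 f) (hmono : Monotone f) {a b : ℝ} (ha : f a = 0)
    (hb : f b = 1) (hab : a ≤ b) :
    ∫ t in a..b, speed (c ∘ f) t = length c := by
  have hd (t : ℝ) : HasDerivAt f (deriv f t) t :=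
    (hf.differentiable one_ne_zero t).hasDerivAt
  have himg : f '' uIcc a b ⊆ Icc 0 1 := by
    rw [uIcc_of_le hab]
    rintro _ ⟨t, ht, rfl⟩
    exact ⟨ha ▸ hmono ht.1, hb ▸ hmono ht.2⟩
  calc ∫ t in a..b, speed (c ∘ f) t = ∫ t in a..b, (speed c ∘ f) t * deriv f t :=
        intervalIntegral.integral_congr fun t _ => by
          simp only [speed_comp hc (hd t), abs_of_nonneg hmono.deriv_nonneg, mul_comm,
            Function.comp_apply]
    _ = ∫ t in f a..f b, speed c t :=
        intervalIntegral.integral_comp_mul_deriv'' hf.continuous.continuousOn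
          (fun t _ => (hd t).hasDerivWithinAt) (hf.continuous_deriv le_rfl).continuousOn
          (continuousOn_speed hc fun t ht => hpos t (himg ht))
    _ = length c := by rw [ha, hb]; rfl

end Length

section Distance

open scoped Matrix.Norms.Operator

variable {ι : Type*} [Fintype ι] {S : Set (Matrix ι ι ℝ)} {X Y Z : Matrix ι ι ℝ}
  {c d : ℝ → Matrix ι ι ℝ}

/-- `c` is one of the curves that compete in the definition of `rho S X Y`. -/
structure IsPath (S : Set (Matrix ι ι ℝ)) (X Y : Matrix ι ι ℝ) (c : ℝ → Matrix ι ι ℝ) : Prop where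
  contDiff : ContDiff ℝ 1 c
  mem : ∀ t ∈ Icc (0 : ℝ) 1, c t ∈ S
  source : c 0 = X
  target : c 1 = Y

/-- The concatenation of a curve from `X` to `Y` and a curve from `Y` to `Z`. The smooth
reparametrizations make it stop at `Y`, so that it is `C¹`. -/
noncomputable def concat (Y : Matrix ι ι ℝ) (c d : ℝ → Matrix ι ι ℝ) (t : ℝ) : Matrix ι ι ℝ :=
  c (smoothTransition (2 * t)) + d (smoothTransition (2 * t - 1)) - Y

theorem concat_of_le (hd : IsPath S Y Z d) {t : ℝ} (ht : t ≤ 1 / 2) :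
    concat Y c d t = c (smoothTransition (2 * t)) := by
  rw [concat, smoothTransition.zero_of_nonpos (by linarith : 2 * t - 1 ≤ 0), hd.source,
    add_sub_cancel_right]

theorem concat_of_ge (hc : IsPath S X Y c) {t : ℝ} (ht : 1 / 2 ≤ t) :
    concat Y c d t = d (smoothTransition (2 * t - 1)) := by
  rw [concat, smoothTransition.one_of_one_le (by linarith : 1 ≤ 2 * t), hc.target,
    add_sub_cancel_left]

theorem isPath_concat (hc : IsPath S X Y c) (hd : IsPath S Y Z d) :
    IsPath S X Z (concat Y c d) where
  contDiff := by
    have hφ : ContDiff ℝ 1 smoothTransition := smoothTransition.contDiff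
    exact ((hc.contDiff.comp (hφ.comp (contDiff_const.mul contDiff_id))).add (hd.contDiff.comp
      (hφ.comp ((contDiff_const.mul contDiff_id).sub contDiff_const)))).sub contDiff_const
  mem t _ := by
    rcases le_total t (1 / 2) with h | h
    · rw [concat_of_le hd h]
      exact hc.mem _ ⟨smoothTransition.nonneg _, smoothTransition.le_one _⟩
    · rw [concat_of_ge hc h]
      exact hd.mem _ ⟨smoothTransition.nonneg _, smoothTransition.le_one _⟩
  source := by
    rw [concat_of_le hd (by norm_num), mul_zero, smoothTransition.zero, hc.source]
  target := by
    rw [concat_of_ge hc (by norm_num), smoothTransition.one_of_one_le (by norm_num), hd.target]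

variable [DecidableEq ι] {p : Prop}

theorem rho_eq (S : Set (Matrix ι ι ℝ)) (X Y : Matrix ι ι ℝ) :
    rho S X Y = sInf (length '' {c | IsPath S X Y c}) := by
  unfold rho
  congr 1
  ext r
  constructor
  · rintro ⟨c, hc, hmem, h0, h1, rfl⟩
    exact ⟨c, ⟨contDiff_matrix.2 hc, hmem, h0, h1⟩, rfl⟩
  · rintro ⟨c, ⟨hc, hmem, h0, h1⟩, rfl⟩
    exact ⟨c, contDiff_matrix.1 hc, hmem, h0, h1, rfl⟩

theorem rho_nonneg (S : Set (Matrix ι ι ℝ)) (X Y : Matrix ι ι ℝ) : 0 ≤ rho S X Y := by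
  rw [rho_eq]
  exact Real.sInf_nonneg (forall_mem_image.2 fun c _ => length_nonneg c)

theorem rho_le_length (h : IsPath S X Y c) : rho S X Y ≤ length c := by
  rw [rho_eq]
  exact csInf_le ⟨0, forall_mem_image.2 fun c _ => length_nonneg c⟩ (mem_image_of_mem _ h)

theorem isPath_expCurve {k : Matrix ι ι ℝ} {l : ι → ℝ} (hk : Preserves p k)
    (hl : p → ∑ i, l i = 0) : IsPath (slice p ι) (k * kᵀ) (expCurve k l 1) (expCurve k l) :=
  ⟨contDiff_expCurve k l 1, fun t _ => expCurve_mem hk hl t, expCurve_zero k l, rfl⟩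

theorem exists_isPath_length_lt (hX : X ∈ slice p ι) (hY : Y ∈ slice p ι) {r : ℝ}
    (hr : rho (slice p ι) X Y < r) : ∃ c, IsPath (slice p ι) X Y c ∧ length c < r := by
  rw [rho_eq] at hr
  have hne : {c | IsPath (slice p ι) X Y c}.Nonempty := by
    obtain ⟨k, l, hk, hl, rfl, rfl⟩ := exists_expCurve hX hY
    exact ⟨_, isPath_expCurve hk hl⟩
  simpa only [exists_mem_image, mem_ofPred_eq] using exists_lt_of_csInf_lt (hne.image length) hr

theorem le_rho (hX : X ∈ slice p ι) (hY : Y ∈ slice p ι) {r : ℝ}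
    (h : ∀ c, IsPath (slice p ι) X Y c → r ≤ length c) : r ≤ rho (slice p ι) X Y := by
  by_contra! hlt
  obtain ⟨c, hc, hl⟩ := exists_isPath_length_lt hX hY hlt
  exact (h c hc).not_gt hl

theorem rho_congr_le {h : Matrix ι ι ℝ} (hh : Preserves p h) (hX : X ∈ slice p ι)
    (hY : Y ∈ slice p ι) :
    rho (slice p ι) (h * X * hᵀ) (h * Y * hᵀ) ≤ rho (slice p ι) X Y := by
  refine le_rho hX hY fun c hc => ?_
  have hpath : IsPath (slice p ι) (h * X * hᵀ) (h * Y * hᵀ) fun t => h * c t * hᵀ :=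
    ⟨(contDiff_const.mul hc.contDiff).mul contDiff_const,
      fun t ht => congr_mem_slice hh (hc.mem t ht), by rw [hc.source], by rw [hc.target]⟩
  exact (rho_le_length hpath).trans_eq <|
    intervalIntegral.integral_congr fun t _ => speed_congr_const hh.isUnit hc.contDiff t

theorem rho_congr {h : Matrix ι ι ℝ} (hh : Preserves p h) (hX : X ∈ slice p ι)
    (hY : Y ∈ slice p ι) :
    rho (slice p ι) (h * X * hᵀ) (h * Y * hᵀ) = rho (slice p ι) X Y := by
  refine (rho_congr_le hh hX hY).antisymm ?_
  simpa only [congr_inv_congr hh.isUnit] using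
    rho_congr_le hh.inv (congr_mem_slice hh hX) (congr_mem_slice hh hY)

theorem rho_comm_le (hX : X ∈ slice p ι) (hY : Y ∈ slice p ι) :
    rho (slice p ι) Y X ≤ rho (slice p ι) X Y := by
  refine le_rho hX hY fun c hc => ?_
  have hpath : IsPath (slice p ι) Y X (c ∘ fun t => 1 - t) :=
    ⟨hc.contDiff.comp (contDiff_const.sub contDiff_id),
      fun t ht => hc.mem _ ⟨sub_nonneg.2 ht.2, sub_le_self _ ht.1⟩,
      by simpa using hc.target, by simpa using hc.source⟩
  have hspeed (t : ℝ) : speed (c ∘ fun t => 1 - t) t = speed c (1 - t) := by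
    simpa using speed_comp hc.contDiff ((hasDerivAt_id t).const_sub 1)
  refine (rho_le_length hpath).trans_eq ?_
  calc length (c ∘ fun t => 1 - t) = ∫ t in (0 : ℝ)..1, speed c (1 - t) :=
        intervalIntegral.integral_congr fun t _ => hspeed t
    _ = length c := by
      rw [intervalIntegral.integral_comp_sub_left (speed c), sub_self, sub_zero]; rfl

theorem rho_comm (hX : X ∈ slice p ι) (hY : Y ∈ slice p ι) :
    rho (slice p ι) X Y = rho (slice p ι) Y X :=
  (rho_comm_le hY hX).antisymm (rho_comm_le hX hY)

theorem rho_self (hX : X ∈ slice p ι) : rho (slice p ι) X X = 0 := by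
  have hpath : IsPath (slice p ι) X X fun _ => X := ⟨contDiff_const, fun _ _ => hX, rfl, rfl⟩
  refine ((rho_le_length hpath).trans_eq ?_).antisymm (rho_nonneg _ _ _)
  simp [length, velocity_eq_of_hasDerivAt (hasDerivAt_const _ X), metric]

theorem intervalIntegrable_speed (hS : ∀ X ∈ S, X.PosDef) (hc : IsPath S X Y c) :
    IntervalIntegrable (speed c) MeasureTheory.volume 0 1 := by
  refine ContinuousOn.intervalIntegrable ?_
  rw [uIcc_of_le zero_le_one]
  exact continuousOn_speed hc.contDiff fun t ht => hS _ (hc.mem t ht)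

theorem length_concat (hS : ∀ X ∈ S, X.PosDef) (hc : IsPath S X Y c) (hd : IsPath S Y Z d) :
    length (concat Y c d) = length c + length d := by
  have hφ : ContDiff ℝ 1 smoothTransition := smoothTransition.contDiff
  have hleft : ∫ t in (0 : ℝ)..1 / 2, speed (concat Y c d) t = length c := by
    rw [← integral_speed_comp hc.contDiff (fun t ht => hS _ (hc.mem t ht))
      (f := fun t => smoothTransition (2 * t)) (hφ.comp (contDiff_const.mul contDiff_id))
      (fun s t hst => smoothTransition.monotone (by linarith))
      (smoothTransition.zero_of_nonpos (by norm_num))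
      (smoothTransition.one_of_one_le (by norm_num)) (by norm_num : (0 : ℝ) ≤ 1 / 2)]
    refine intervalIntegral.integral_congr_Ioo_of_le (by norm_num) fun t ht => speed_congr ?_
    filter_upwards [Iio_mem_nhds ht.2] with s hs using concat_of_le hd (le_of_lt hs)
  have hright : ∫ t in (1 / 2 : ℝ)..1, speed (concat Y c d) t = length d := by
    rw [← integral_speed_comp hd.contDiff (fun t ht => hS _ (hd.mem t ht))
      (f := fun t => smoothTransition (2 * t - 1))
      (hφ.comp ((contDiff_const.mul contDiff_id).sub contDiff_const))
      (fun s t hst => smoothTransition.monotone (by linarith))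
      (smoothTransition.zero_of_nonpos (by norm_num))
      (smoothTransition.one_of_one_le (by norm_num)) (by norm_num : (1 / 2 : ℝ) ≤ 1)]
    refine intervalIntegral.integral_congr_Ioo_of_le (by norm_num) fun t ht => speed_congr ?_
    filter_upwards [Ioi_mem_nhds ht.1] with s hs using concat_of_ge hc (le_of_lt hs)
  have hint := intervalIntegrable_speed hS (isPath_concat hc hd)
  have hmem : (1 / 2 : ℝ) ∈ uIcc 0 1 := by
    rw [uIcc_of_le zero_le_one]
    constructor <;> norm_num
  rw [← hleft, ← hright, intervalIntegral.integral_add_adjacent_intervals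
    (hint.mono_set (uIcc_subset_uIcc_left hmem)) (hint.mono_set (uIcc_subset_uIcc_right hmem))]
  rfl

theorem rho_triangle (hX : X ∈ slice p ι) (hY : Y ∈ slice p ι) (hZ : Z ∈ slice p ι) :
    rho (slice p ι) X Z ≤ rho (slice p ι) X Y + rho (slice p ι) Y Z := by
  refine le_of_forall_pos_le_add fun ε hε => ?_
  obtain ⟨c, hc, hcl⟩ := exists_isPath_length_lt hX hY
    (lt_add_of_pos_right (rho (slice p ι) X Y) (half_pos hε))
  obtain ⟨d, hd, hdl⟩ := exists_isPath_length_lt hY hZ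
    (lt_add_of_pos_right (rho (slice p ι) Y Z) (half_pos hε))
  have := rho_le_length (isPath_concat hc hd)
  rw [length_concat (fun X hX => hX.1) hc hd] at this
  linarith

theorem abs_div_le_speed {t : ℝ} (h : ∀ᶠ s in 𝓝 t, (c s).PosDef) {v : ι → ℝ} (hv : v ≠ 0) :
    |(v ⬝ᵥ velocity c t *ᵥ v) / (v ⬝ᵥ c t *ᵥ v)| ≤ speed c t := by
  have hX := h.self_of_nhds
  have hpos := dotProduct_pos hX hv
  rw [abs_div, abs_of_pos hpos, div_le_iff₀ hpos]
  refine abs_le_of_sq_le_sq ?_ (mul_nonneg (speed_nonneg c t) hpos.le)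
  rw [mul_pow, speed, sq_sqrt (metric_self_nonneg hX (isSymm_velocity h)), mul_comm]
  exact sq_dotProduct_le_metric hX (isSymm_velocity h) v

theorem abs_log_sub_log_le_rho (hX : X ∈ slice p ι) (hY : Y ∈ slice p ι) {v : ι → ℝ}
    (hv : v ≠ 0) :
    |log (v ⬝ᵥ X *ᵥ v) - log (v ⬝ᵥ Y *ᵥ v)| ≤ rho (slice p ι) X Y := by
  refine le_rho hX hY fun c hc => ?_
  have hpos : ∀ t ∈ uIcc (0 : ℝ) 1, v ⬝ᵥ c t *ᵥ v ≠ 0 := by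
    rw [uIcc_of_le zero_le_one]
    exact fun t ht => (dotProduct_pos (hc.mem t ht).1 hv).ne'
  have hcont : ContinuousOn (fun t => (v ⬝ᵥ velocity c t *ᵥ v) / (v ⬝ᵥ c t *ᵥ v))
      (uIcc (0 : ℝ) 1) := by
    have hc1 : Continuous c := hc.contDiff.continuous
    have hv1 := continuous_velocity hc.contDiff
    exact (continuous_const.dotProduct (hv1.matrix_mulVec continuous_const)).continuousOn.div
      (continuous_const.dotProduct (hc1.matrix_mulVec continuous_const)).continuousOn hpos
  have hftc := intervalIntegral.integral_eq_sub_of_hasDerivAt (fun t ht =>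
    (hasDerivAt_dotProduct (hasDerivAt_velocity hc.contDiff one_ne_zero t) v).log (hpos t ht))
    hcont.intervalIntegrable
  rw [hc.source, hc.target] at hftc
  rw [abs_sub_comm, ← hftc]
  refine (intervalIntegral.abs_integral_le_integral_abs zero_le_one).trans ?_
  refine intervalIntegral.integral_mono_on_of_le_Ioo zero_le_one hcont.intervalIntegrable.abs
    (intervalIntegrable_speed (fun X hX => hX.1) hc) fun t ht => abs_div_le_speed ?_ hv
  filter_upwards [Icc_mem_nhds ht.1 ht.2] with s hs using (hc.mem s hs).1

theorem rho_expCurve_one_le {k : Matrix ι ι ℝ} {l : ι → ℝ} (hk : Preserves p k)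
    (hl : p → ∑ i, l i = 0) :
    rho (slice p ι) (k * kᵀ) (expCurve k l 1) ≤ √(∑ i, l i ^ 2) :=
  (rho_le_length (isPath_expCurve hk hl)).trans_eq (length_expCurve hk.isUnit l)

theorem sq_le_exp_add_exp_neg (x : ℝ) : x ^ 2 ≤ exp x + exp (-x) - 2 := by
  have h : x ^ 2 / 4 ≤ sinh (x / 2) ^ 2 := by
    have := self_le_sinh_iff.2 (abs_nonneg (x / 2))
    rw [← abs_sinh] at this
    linarith [sq_le_sq.2 this]
  have hcosh : cosh x = 2 * sinh (x / 2) ^ 2 + 1 := by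
    have := cosh_two_mul (x / 2)
    rw [cosh_sq, mul_div_cancel₀ x two_ne_zero] at this
    linarith
  rw [cosh_eq] at hcosh
  linarith

theorem rho_le_sqrt_trace (hX : X ∈ slice p ι) (hY : Y ∈ slice p ι) :
    rho (slice p ι) X Y ≤
      √((X⁻¹ * Y).trace + (Y⁻¹ * X).trace - 2 * Fintype.card ι) := by
  obtain ⟨k, l, hk, hl, rfl, rfl⟩ := exists_expCurve hX hY
  have hXY : ((k * kᵀ)⁻¹ * expCurve k l 1).trace = ∑ i, exp (l i) := by
    simp [expCurve, trace_inv_mul_congr hk.isUnit, expDiag]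
  have hYX : ((expCurve k l 1)⁻¹ * (k * kᵀ)).trace = ∑ i, exp (-l i) := by
    rw [← expCurve_zero k l, ← add_neg_cancel (1 : ℝ), expCurve_add, expCurve_eq_mul_transpose,
      expCurve, trace_inv_mul_congr (hk.mul (preserves_expDiag hl _)).isUnit]
    simp [expDiag]
  refine (rho_expCurve_one_le hk hl).trans (sqrt_le_sqrt ?_)
  calc ∑ i, l i ^ 2 ≤ ∑ i, (exp (l i) + exp (-l i) - 2) :=
        Finset.sum_le_sum fun i _ => sq_le_exp_add_exp_neg (l i)
    _ = _ := by
      rw [hXY, hYX, Finset.sum_sub_distrib, Finset.sum_add_distrib, Finset.sum_const,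
        Finset.card_univ, nsmul_eq_mul, mul_comm (Fintype.card ι : ℝ)]

theorem tendsto_rho {β : Type*} {F : Filter β} {f : β → Matrix ι ι ℝ}
    (hf : ∀ᶠ b in F, f b ∈ slice p ι) (hX : X ∈ slice p ι) (h : Tendsto f F (𝓝 X)) :
    Tendsto (fun b => rho (slice p ι) X (f b)) F (𝓝 0) := by
  have hu : IsUnit X.det := hX.1.det_pos.ne'.isUnit
  have hcont : ContinuousAt
      (fun Y => √((X⁻¹ * Y).trace + (Y⁻¹ * X).trace - 2 * Fintype.card ι)) X := by
    have hinv : ContinuousAt (fun Y : Matrix ι ι ℝ => Y⁻¹) X := by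
      simp only [inv_def, Ring.inverse_eq_inv']
      exact (continuous_id.matrix_det.continuousAt.inv₀ hu.ne_zero).smul
        continuous_id.matrix_adjugate.continuousAt
    have htr : Continuous (trace : Matrix ι ι ℝ → ℝ) := continuous_id.matrix_trace
    exact ((htr.continuousAt.comp (continuousAt_const.mul continuousAt_id)).add
      (htr.continuousAt.comp (hinv.mul continuousAt_const))).sub continuousAt_const |>.sqrt
  have hlim := hcont.tendsto.comp h
  simp only [nonsing_inv_mul _ hu, trace_one, ← two_mul, sub_self, sqrt_zero] at hlim
  exact squeeze_zero' (Eventually.of_forall fun b => rho_nonneg _ _ _)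
    (hf.mono fun b hb => rho_le_sqrt_trace hX hb) hlim

end Distance

section Geodesic

open scoped Matrix.Norms.Operator

variable {ι : Type*} [Fintype ι] [DecidableEq ι] {p : Prop} {k U V W X Y : Matrix ι ι ℝ}
  {l : ι → ℝ} {μ : ℝ → Matrix ι ι ℝ} {t : ℝ}

theorem isUnit_det_of_mem_slice (hX : X ∈ slice p ι) : IsUnit X.det := hX.1.det_pos.ne'.isUnit

theorem mem_tangentTo (hX : X ∈ slice p ι) (hW : W.IsSymm) (h : p → (X⁻¹ * W).trace = 0) :
    W ∈ tangentTo (slice p ι) X := by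
  obtain ⟨k, l, hk, rfl, rfl⟩ := exists_simultaneous_diagonal hX.1 hW
  have hl (hp : p) : ∑ i, l i = 0 := by
    simpa only [trace_inv_mul_congr hk, trace_diagonal] using h hp
  refine ⟨expCurve k l, expCurve_zero k l,
    .of_forall (expCurve_mem (preserves_of_mul_transpose_mem hX) hl), hasDerivAt_matrix.1 ?_⟩
  simpa only [expDiag_zero, Matrix.mul_one] using hasDerivAt_expCurve' k l 0

theorem card_le_trace_inv_mul (hp : p) (hX : X ∈ slice p ι) (hY : Y ∈ slice p ι) :
    (Fintype.card ι : ℝ) ≤ (X⁻¹ * Y).trace := by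
  obtain ⟨k, l, hk, hl, rfl, rfl⟩ := exists_expCurve hX hY
  rw [expCurve, trace_inv_mul_congr hk.isUnit, expDiag, trace_diagonal]
  calc (Fintype.card ι : ℝ) = ∑ i, (l i * 1 + 1) := by
        simp [Finset.sum_add_distrib, hl hp]
    _ ≤ ∑ i, exp (l i * 1) := Finset.sum_le_sum fun i _ => add_one_le_exp _

theorem trace_inv_mul_velocity (hp : p) (hμ : ∀ s, μ s ∈ slice p ι) (hV : HasDerivAt μ V t) :
    ((μ t)⁻¹ * V).trace = 0 := by
  refine IsLocalMin.hasDerivAt_eq_zero (.of_forall fun s => ?_)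
    (hasDerivAt_trace (hV.const_mul (μ t)⁻¹))
  simpa only [nonsing_inv_mul _ (isUnit_det_of_mem_slice (hμ t)), trace_one] using
    card_le_trace_inv_mul hp (hμ t) (hμ s)

theorem hasDerivAt_mul_inv {v : ℝ → Matrix ι ι ℝ} (hμ : HasDerivAt μ W t) (hv : HasDerivAt v U t)
    (h : IsUnit (μ t).det) :
    HasDerivAt (fun s => v s * (μ s)⁻¹) ((U - v t * (μ t)⁻¹ * W) * (μ t)⁻¹) t := by
  have hd := hv.mul (hasDerivAt_inv hμ h)
  rw [Matrix.mul_neg, ← sub_eq_add_neg, ← Matrix.mul_assoc, ← Matrix.mul_assoc,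
    ← Matrix.sub_mul] at hd
  exact hd

theorem hasDerivAt_metric {v w : ℝ → Matrix ι ι ℝ} {X' V' W' : Matrix ι ι ℝ}
    (hμ : HasDerivAt μ X' t) (hv : HasDerivAt v V' t) (hw : HasDerivAt w W' t)
    (h : IsUnit (μ t).det) :
    HasDerivAt (fun s => metric (μ s) (v s) (w s))
      (metric (μ t) (V' - v t * (μ t)⁻¹ * X') (w t) +
        metric (μ t) (v t) (W' - w t * (μ t)⁻¹ * X')) t := by
  have hd := hasDerivAt_trace ((hasDerivAt_mul_inv hμ hv h).mul (hasDerivAt_mul_inv hμ hw h))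
  simp only [trace_add, ← Matrix.mul_assoc] at hd
  simpa only [metric, Pi.mul_apply, ← Matrix.mul_assoc] using hd

theorem geodesic_equation_iff (hμ : HasDerivAt μ (velocity μ t) t)
    (hv : HasDerivAt (velocity μ) U t) (h : IsUnit (μ t).det) (W : Matrix ι ι ℝ) :
    deriv (fun s => metric (μ s) (velocity μ s) W) t =
        1 / 2 * deriv (fun ε : ℝ => metric (μ t + ε • W) (velocity μ t) (velocity μ t)) 0 ↔
      metric (μ t) (U - velocity μ t * (μ t)⁻¹ * velocity μ t) W = 0 := by
  have hbase : HasDerivAt (fun ε : ℝ => μ t + ε • W) W 0 := by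
    have := ((hasDerivAt_id (0 : ℝ)).smul_const W).const_add (μ t)
    rwa [one_smul] at this
  have hL := hasDerivAt_metric hμ hv (hasDerivAt_const t W) h
  have hR := hasDerivAt_metric hbase (hasDerivAt_const 0 (velocity μ t))
    (hasDerivAt_const 0 (velocity μ t)) (by simpa using h)
  set V := velocity μ t
  have hcycle : metric (μ t) V (W * (μ t)⁻¹ * V) = metric (μ t) V (V * (μ t)⁻¹ * W) := by
    calc metric (μ t) V (W * (μ t)⁻¹ * V) = metric (μ t) (W * (μ t)⁻¹ * V) V := metric_comm ..
      _ = metric (μ t) W (V * (μ t)⁻¹ * V) := by simp only [metric, Matrix.mul_assoc]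
      _ = metric (μ t) (V * (μ t)⁻¹ * V) W := metric_comm ..
      _ = metric (μ t) V (V * (μ t)⁻¹ * W) := by simp only [metric, Matrix.mul_assoc]
  have hneg (P Q : Matrix ι ι ℝ) : metric (μ t) P (0 - Q) = -metric (μ t) P Q := by
    simp only [metric, zero_sub, Matrix.mul_neg, Matrix.neg_mul, trace_neg]
  rw [hL.deriv, hR.deriv, zero_smul, add_zero, metric_comm _ (0 - _), hneg, hneg, hcycle]
  constructor <;> intro _ <;> linarith

theorem isGeodesic_expCurve (hk : Preserves p k) (hl : p → ∑ i, l i = 0) (hne : l ≠ 0) :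
    IsGeodesic (slice p ι) (expCurve k l) where
  smooth := contDiff_matrix.1 (contDiff_expCurve k l ∞)
  mem := expCurve_mem hk hl
  nonconstant := by
    refine ⟨0, 1, fun h => hne (funext fun i => ?_)⟩
    have hE : expDiag l 0 = expDiag l 1 := by
      rw [← congr_inv_congr hk.isUnit (expDiag l 0), ← congr_inv_congr hk.isUnit (expDiag l 1)]
      exact congrArg (fun X => k⁻¹ * X * k⁻¹ᵀ) h
    have hexp : exp (l i * 0) = exp (l i * 1) := congrFun (diagonal_injective hE) i
    simpa using (exp_injective hexp).symm
  equation t W _ := by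
    set A := k * diagonal l * k⁻¹
    have hv (s : ℝ) : HasDerivAt (expCurve k l) (A * expCurve k l s) s :=
      hasDerivAt_expCurve hk.isUnit l s
    have hvel : velocity (expCurve k l) = fun s => A * expCurve k l s :=
      funext fun s => velocity_eq_of_hasDerivAt (hv s)
    have hacc : HasDerivAt (velocity (expCurve k l)) (A * (A * expCurve k l t)) t := by
      rw [hvel]
      exact (hv t).const_mul A
    have hu := isUnit_det_of_mem_slice (expCurve_mem hk hl t)
    rw [geodesic_equation_iff (by rw [hvel]; exact hv t) hacc hu, hvel]
    simp [mul_nonsing_inv_cancel_right _ _ hu, metric]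

theorem acceleration_eq (hμ : IsGeodesic (slice p ι) μ) (t : ℝ) :
    HasDerivAt (velocity μ) (velocity μ t * (μ t)⁻¹ * velocity μ t) t := by
  have hvel := hasDerivAt_velocity (contDiff_matrix.2 hμ.smooth) (by simp)
  have hacc := hasDerivAt_velocity (contDiff_matrix.2 fun i j =>
    (contDiff_infty_iff_deriv.1 (hμ.smooth i j)).2) (by simp) t
  change HasDerivAt (velocity μ) (velocity (velocity μ) t) t at hacc
  have hu := isUnit_det_of_mem_slice (hμ.mem t)
  have hV (s : ℝ) : (velocity μ s).IsSymm := isSymm_velocity (.of_forall fun s => (hμ.mem s).1)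
  set V := velocity μ t
  set U := velocity (velocity μ) t
  have hsymm : (U - V * (μ t)⁻¹ * V).IsSymm := by
    have hU : U.IsSymm := by
      ext i j
      exact congrArg (deriv · t) (funext fun s => (hV s).apply i j)
    have hμs := isSymm_of_posDef (hμ.mem t).1
    simp only [IsSymm, transpose_sub, transpose_mul, transpose_nonsing_inv, hU.eq, (hV t).eq,
      hμs.eq, Matrix.mul_assoc, V]
  have htrace (hp : p) : ((μ t)⁻¹ * (U - V * (μ t)⁻¹ * V)).trace = 0 := by
    have hd := hasDerivAt_trace (hasDerivAt_mul_inv (hvel t) hacc hu)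
    have hzero : (fun s => (velocity μ s * (μ s)⁻¹).trace) = fun _ => 0 := funext fun s => by
      rw [trace_mul_comm, trace_inv_mul_velocity hp hμ.mem (hvel s)]
    rw [hzero] at hd
    rw [trace_mul_comm, hd.unique (hasDerivAt_const t 0)]
  have horth := (geodesic_equation_iff (hvel t) hacc hu _).1
    (hμ.equation t _ (mem_tangentTo (hμ.mem t) hsymm htrace))
  rwa [← sub_eq_zero.1 (eq_zero_of_metric_self (hμ.mem t).1 hsymm horth)]

theorem eq_expCurve_of_hasDerivAt (hk : IsUnit k.det)
    (hμ : ∀ t, HasDerivAt μ (k * diagonal l * k⁻¹ * μ t) t) (h0 : μ 0 = k * kᵀ) :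
    μ = expCurve k l :=
  ODE_solution_unique_univ (v := fun _ X => k * diagonal l * k⁻¹ * X) (s := fun _ => univ)
    (fun _ => (ContinuousLinearMap.mul ℝ _ (k * diagonal l * k⁻¹)).lipschitz.lipschitzOnWith)
    (fun t => ⟨hμ t, mem_univ _⟩) (fun t => ⟨hasDerivAt_expCurve hk l t, mem_univ _⟩)
    (h0.trans (expCurve_zero k l).symm)

theorem velocity_mul_inv_eq (hμ : IsGeodesic (slice p ι) μ) (t : ℝ) :
    velocity μ t * (μ t)⁻¹ = velocity μ 0 * (μ 0)⁻¹ := by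
  have hd (s : ℝ) : HasDerivAt (fun s => velocity μ s * (μ s)⁻¹) 0 s := by
    have := hasDerivAt_mul_inv
      (hasDerivAt_velocity (contDiff_matrix.2 hμ.smooth) (by simp) s) (acceleration_eq hμ s)
      (isUnit_det_of_mem_slice (hμ.mem s))
    rwa [sub_self, Matrix.zero_mul] at this
  exact is_const_of_deriv_eq_zero (fun s => (hd s).differentiableAt) (fun s => (hd s).deriv) t 0

theorem isGeodesic_iff : IsGeodesic (slice p ι) μ ↔
    ∃ (k : Matrix ι ι ℝ) (l : ι → ℝ), Preserves p k ∧ (p → ∑ i, l i = 0) ∧ l ≠ 0 ∧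
      μ = expCurve k l := by
  refine ⟨fun hμ => ?_, fun ⟨k, l, hk, hl, hne, h⟩ => h ▸ isGeodesic_expCurve hk hl hne⟩
  have hvel := hasDerivAt_velocity (contDiff_matrix.2 hμ.smooth) (by simp)
  obtain ⟨k, l, hk, h0, hV0⟩ := exists_simultaneous_diagonal (hμ.mem 0).1
    (isSymm_velocity (.of_forall fun s => (hμ.mem s).1))
  have hp : Preserves p k := preserves_of_mul_transpose_mem (h0 ▸ hμ.mem 0)
  have hV (t : ℝ) : velocity μ t = k * diagonal l * k⁻¹ * μ t := by
    have hA : velocity μ 0 * (μ 0)⁻¹ = k * diagonal l * k⁻¹ := by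
      rw [h0, hV0]
      simpa only [Matrix.mul_one, inv_one] using congr_mul_inv_congr hk (diagonal l) 1
    rw [← hA, ← velocity_mul_inv_eq hμ t,
      nonsing_inv_mul_cancel_right _ _ (isUnit_det_of_mem_slice (hμ.mem t))]
  have hμk := eq_expCurve_of_hasDerivAt hk (fun t => hV t ▸ hvel t) h0
  refine ⟨k, l, hp, fun h => ?_, ?_, hμk⟩
  · have htrace := trace_inv_mul_velocity h hμ.mem (hvel 0)
    rwa [h0, hV0, trace_inv_mul_congr hk, trace_diagonal] at htrace
  · rintro rfl
    obtain ⟨s, t, hst⟩ := hμ.nonconstant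
    exact hst (by simp [hμk, expCurve, expDiag])

end Geodesic

section Triangular

variable {ι : Type*} {l : ι → ℝ} {g h D : Matrix ι ι ℝ}

/-- The block diagonal part of `h`, the blocks being those on which `l` is constant. Block
triangularity, for the blocks in the order of decreasing `l`, is `h.BlockTriangular (-l)`. -/
noncomputable def blockPart (l : ι → ℝ) (h : Matrix ι ι ℝ) : Matrix ι ι ℝ :=
  of fun i j => if l i = l j then h i j else 0

theorem blockPart_blockPart (l : ι → ℝ) (h : Matrix ι ι ℝ) :
    blockPart l (blockPart l h) = blockPart l h := by
  ext i j
  simp only [blockPart, of_apply]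
  split_ifs <;> rfl

theorem blockTriangular_blockPart (l : ι → ℝ) (h : Matrix ι ι ℝ) :
    (blockPart l h).BlockTriangular (-l) := fun _ _ hij => if_neg (neg_lt_neg_iff.1 hij).ne

variable [DecidableEq ι]

theorem blockPart_one (l : ι → ℝ) : blockPart l (1 : Matrix ι ι ℝ) = 1 := by
  ext i j
  rcases eq_or_ne i j with rfl | hij <;> simp [blockPart, *]

variable [Fintype ι]

/-- The conjugate of `h` by `exp(-(t / 2) · diag l)`. -/
noncomputable def conjDiag (l : ι → ℝ) (h : Matrix ι ι ℝ) (t : ℝ) : Matrix ι ι ℝ :=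
  expDiag l (-(t / 2)) * h * expDiag l (t / 2)

theorem conjDiag_apply (l : ι → ℝ) (h : Matrix ι ι ℝ) (t : ℝ) (i j : ι) :
    conjDiag l h t i j = h i j * exp ((l j - l i) / 2 * t) := by
  have hexp : (l j - l i) / 2 * t = l i * -(t / 2) + l j * (t / 2) := by ring
  rw [conjDiag, expDiag, expDiag, mul_diagonal, diagonal_mul, hexp, exp_add]
  ring

theorem expDiag_mul_conjDiag (l : ι → ℝ) (h : Matrix ι ι ℝ) (t : ℝ) :
    expDiag l (t / 2) * conjDiag l h t = h * expDiag l (t / 2) := by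
  rw [conjDiag, Matrix.mul_assoc, ← Matrix.mul_assoc, expDiag_mul_expDiag_neg, Matrix.one_mul]

theorem det_conjDiag (l : ι → ℝ) (h : Matrix ι ι ℝ) (t : ℝ) :
    (conjDiag l h t).det = h.det := by
  rw [conjDiag, det_mul_right_comm, ← expDiag_add, neg_add_cancel, expDiag_zero, Matrix.one_mul]

theorem tendsto_conjDiag (hT : h.BlockTriangular (-l)) :
    Tendsto (conjDiag l h) atTop (𝓝 (blockPart l h)) := by
  refine tendsto_pi_nhds.2 fun i => tendsto_pi_nhds.2 fun j => ?_
  simp only [conjDiag_apply, blockPart, of_apply]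
  rcases lt_trichotomy (l i) (l j) with hij | hij | hij
  · simp [hT (neg_lt_neg hij), hij.ne]
  · simp [hij]
  · rw [if_neg hij.ne', ← mul_zero (h i j)]
    exact (tendsto_exp_atBot.comp
      (tendsto_id.const_mul_atTop_of_neg (by linarith))).const_mul (h i j)

theorem det_blockPart (hT : h.BlockTriangular (-l)) : (blockPart l h).det = h.det := by
  have hlim := ((continuous_id.matrix_det).tendsto (blockPart l h)).comp (tendsto_conjDiag hT)
  refine tendsto_nhds_unique hlim (tendsto_const_nhds.congr fun t => ?_)
  exact (det_conjDiag l h t).symm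

theorem conjDiag_mul (l : ι → ℝ) (g h : Matrix ι ι ℝ) (t : ℝ) :
    conjDiag l (g * h) t = conjDiag l g t * conjDiag l h t := by
  rw [conjDiag, ← Matrix.mul_assoc, Matrix.mul_assoc, ← expDiag_mul_conjDiag]
  simp only [conjDiag, Matrix.mul_assoc]

omit [DecidableEq ι] in
theorem blockPart_mul (hg : g.BlockTriangular (-l)) (hh : h.BlockTriangular (-l)) :
    blockPart l (g * h) = blockPart l g * blockPart l h := by
  classical
  exact tendsto_nhds_unique ((tendsto_conjDiag (hg.mul hh)).congr (conjDiag_mul l g h))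
    ((tendsto_conjDiag hg).mul (tendsto_conjDiag hh))

theorem blockTriangular_mul_inv_blockPart (hT : h.BlockTriangular (-l)) (hh : IsUnit h.det) :
    (h * (blockPart l h)⁻¹).BlockTriangular (-l) := by
  have := (blockPart l h).invertibleOfIsUnitDet (det_blockPart hT ▸ hh)
  exact hT.mul (blockTriangular_inv_of_blockTriangular (blockTriangular_blockPart l h))

theorem blockPart_mul_inv_blockPart (hT : h.BlockTriangular (-l)) (hh : IsUnit h.det) :
    blockPart l (h * (blockPart l h)⁻¹) = 1 := by
  have hD : IsUnit (blockPart l h).det := det_blockPart hT ▸ hh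
  have := (blockPart l h).invertibleOfIsUnitDet hD
  have hinv := blockTriangular_inv_of_blockTriangular (blockTriangular_blockPart l h)
  calc blockPart l (h * (blockPart l h)⁻¹)
      = blockPart l (blockPart l h * (blockPart l h)⁻¹) := by
        rw [blockPart_mul hT hinv, blockPart_mul (blockTriangular_blockPart l h) hinv,
          blockPart_blockPart]
    _ = 1 := by rw [mul_nonsing_inv _ hD, blockPart_one]

theorem preserves_of_det_eq {p : Prop} (hh : Preserves p h)
    (hdet : g.det = h.det) : Preserves p g where
  isUnit := hdet ▸ hh.isUnit
  det_sq := hdet ▸ hh.det_sq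

theorem commute_blockPart (l : ι → ℝ) (h : Matrix ι ι ℝ) (t : ℝ) :
    Commute (blockPart l h) (expDiag l t) := by
  ext i j
  rw [expDiag, mul_diagonal, diagonal_mul, blockPart, of_apply]
  split_ifs with hij
  · rw [hij, mul_comm]
  · simp

theorem expCurve_eq_congr_conjDiag (l : ι → ℝ) (h : Matrix ι ι ℝ) (t : ℝ) :
    expCurve h l t =
      expDiag l (t / 2) * (conjDiag l h t * (conjDiag l h t)ᵀ) * (expDiag l (t / 2))ᵀ := by
  rw [expCurve_eq_mul_transpose, ← expDiag_mul_conjDiag, transpose_mul]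
  simp only [Matrix.mul_assoc]

theorem expCurve_add_of_commute (hD : ∀ t, Commute D (expDiag l t)) (t s : ℝ) :
    expCurve D l (t + s) = expDiag l (t / 2) * expCurve D l s * (expDiag l (t / 2))ᵀ := by
  rw [expCurve_add, (hD _).eq, expCurve_mul]

end Triangular

section Asymptotics

variable {ι : Type*} [Fintype ι] [DecidableEq ι] {p : Prop} {X Y : Matrix ι ι ℝ}
  {h D k : Matrix ι ι ℝ} {l : ι → ℝ}

theorem preserves_one : Preserves p (1 : Matrix ι ι ℝ) :=
  ⟨by simp, by simp⟩

theorem log_dotProduct_expCurve_one (l : ι → ℝ) (t : ℝ) (i : ι) :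
    log (Pi.single i 1 ⬝ᵥ expCurve 1 l t *ᵥ Pi.single i 1) = l i * t := by
  simp [expCurve, expDiag]

theorem le_rho_expCurve (hk : Preserves p k) (hl : p → ∑ i, l i = 0) (i : ι) (s t : ℝ) :
    |l i| * |s - t| ≤ rho (slice p ι) (expCurve k l s) (expCurve k l t) := by
  have hγ := expCurve_mem (preserves_one (p := p)) hl
  have hlip := abs_log_sub_log_le_rho (hγ s) (hγ t)
    (Pi.single_ne_zero_iff.2 (one_ne_zero' ℝ) : Pi.single i 1 ≠ 0)
  rw [log_dotProduct_expCurve_one, log_dotProduct_expCurve_one, ← mul_sub, abs_mul] at hlip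
  rw [← Matrix.mul_one k, expCurve_mul, expCurve_mul, rho_congr hk (hγ s) (hγ t)]
  exact hlip

theorem eq_of_rho_eq_zero (hX : X ∈ slice p ι) (hY : Y ∈ slice p ι)
    (h0 : rho (slice p ι) X Y = 0) : X = Y := by
  obtain ⟨k, l, hk, hl, rfl, rfl⟩ := exists_expCurve hX hY
  have hl0 : l = 0 := funext fun i => by
    have hle := le_rho_expCurve hk hl i 0 1
    rw [expCurve_zero, h0] at hle
    simpa using hle
  simp [hl0, expCurve, expDiag]

theorem bddBelow_rho {β : Type*} (S : Set (Matrix ι ι ℝ)) (X : Matrix ι ι ℝ)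
    (f : β → Matrix ι ι ℝ) : BddBelow (range fun b => rho S X (f b)) :=
  ⟨0, forall_mem_range.2 fun _ => rho_nonneg _ _ _⟩

theorem rho_expCurve_one_of_commute (hD : ∀ t, Commute D (expDiag l t)) (hp : Preserves p D)
    (hl : p → ∑ i, l i = 0) (t u : ℝ) :
    rho (slice p ι) (expCurve 1 l t) (expCurve D l (t + u)) =
      rho (slice p ι) (expCurve 1 l 0) (expCurve D l u) := by
  rw [expCurve_add_of_commute hD, ← add_zero t,
    expCurve_add_of_commute fun t => Commute.one_left _, add_zero,
    rho_congr (preserves_expDiag hl _) (expCurve_mem preserves_one hl 0) (expCurve_mem hp hl u)]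

theorem tendsto_rho_blockPart (hT : h.BlockTriangular (-l)) (hh : Preserves p h)
    (hl : p → ∑ i, l i = 0) :
    Tendsto (fun s => rho (slice p ι) (expCurve (blockPart l h) l s) (expCurve h l s)) atTop
      (𝓝 0) := by
  have hconj (t : ℝ) : conjDiag l h t * (conjDiag l h t)ᵀ ∈ slice p ι :=
    mul_transpose_mem_slice (preserves_of_det_eq hh (det_conjDiag l h t))
  have hD := mul_transpose_mem_slice (preserves_of_det_eq hh (det_blockPart hT))
  have hcont : Continuous fun A : Matrix ι ι ℝ => A * Aᵀ := by fun_prop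
  refine (tendsto_rho (.of_forall hconj) hD
    ((hcont.tendsto _).comp (tendsto_conjDiag hT))).congr fun t => ?_
  rw [← add_zero t, expCurve_add_of_commute (commute_blockPart l h), add_zero, expCurve_zero,
    expCurve_eq_congr_conjDiag, rho_congr (preserves_expDiag hl _) hD (hconj t)]

theorem abs_rho_sub_rho_blockPart_le (hT : h.BlockTriangular (-l)) (hh : Preserves p h)
    (hl : p → ∑ i, l i = 0) (t u : ℝ) :
    |rho (slice p ι) (expCurve 1 l t) (expCurve h l (t + u)) -
        rho (slice p ι) (expCurve 1 l 0) (expCurve (blockPart l h) l u)| ≤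
      rho (slice p ι) (expCurve (blockPart l h) l (t + u)) (expCurve h l (t + u)) := by
  have hD := preserves_of_det_eq hh (det_blockPart hT)
  have hγ := expCurve_mem (preserves_one (p := p)) hl t
  have hDu := expCurve_mem hD hl (t + u)
  have hhu := expCurve_mem hh hl (t + u)
  rw [← rho_expCurve_one_of_commute (commute_blockPart l h) hD hl t u, abs_le]
  have htri := rho_triangle hγ hhu hDu
  rw [rho_comm hhu hDu] at htri
  constructor <;> linarith [rho_triangle hγ hDu hhu]

theorem coDirected_expCurve (hT : h.BlockTriangular (-l)) (hh : Preserves p h)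
    (hl : p → ∑ i, l i = 0) (hne : l ≠ 0) :
    CoDirected (slice p ι) (expCurve 1 l) (expCurve h l) := by
  intro s₀
  set C := rho (slice p ι) (expCurve 1 l 0) (expCurve (blockPart l h) l 0) + 1
  obtain ⟨i, hi⟩ := Function.ne_iff.1 hne
  have hi' : 0 < |l i| := abs_pos.2 hi
  filter_upwards [(tendsto_rho_blockPart hT hh hl).eventually_le_const one_pos,
    eventually_ge_atTop s₀, eventually_ge_atTop (s₀ + 2 * C / |l i|)] with t hδ ht₀ ht
  have hC : rho (slice p ι) (expCurve 1 l t) (expCurve h l t) ≤ C := by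
    have := (le_abs_self _).trans (abs_rho_sub_rho_blockPart_le hT hh hl t 0)
    rw [add_zero] at this
    linarith
  let f : Ici s₀ → ℝ := fun s => rho (slice p ι) (expCurve 1 l t) (expCurve h l s)
  have hf : BddBelow (range f) := bddBelow_rho _ _ _
  have : Nonempty (Ici s₀) := ⟨⟨s₀, self_mem_Ici⟩⟩
  refine le_antisymm (le_ciInf fun s => ciInf_le (bddBelow_rho _ _ _) _) (le_ciInf fun s => ?_)
  rcases le_total s₀ s with hs | hs
  · exact ciInf_le hf ⟨s, hs⟩
  · -- a point of `h γ hᵀ` with parameter `s ≤ s₀` is farther from `γ(t)` than `h γ(t) hᵀ` is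
    have hγ := expCurve_mem (preserves_one (p := p)) hl t
    have hν := expCurve_mem hh hl
    have htri := rho_triangle (hν t) hγ (hν s)
    rw [rho_comm (hν t) hγ] at htri
    have hfar : 2 * C ≤ |l i| * |t - s| := by
      rw [← div_le_iff₀' hi']
      linarith [le_abs_self (t - s)]
    exact (ciInf_le hf ⟨t, ht₀⟩).trans (by linarith [le_rho_expCurve hh hl i t s])

theorem tendsto_distTo_expCurve (hT : h.BlockTriangular (-l)) (hh : Preserves p h)
    (hl : p → ∑ i, l i = 0) (hne : l ≠ 0) :
    Tendsto (fun t => distTo (slice p ι) (expCurve 1 l t) (expCurve h l)) atTop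
      (𝓝 (distTo (slice p ι) (expCurve 1 l 0) (expCurve (blockPart l h) l))) := by
  set d := fun u => rho (slice p ι) (expCurve 1 l 0) (expCurve (blockPart l h) l u)
  set L := distTo (slice p ι) (expCurve 1 l 0) (expCurve (blockPart l h) l)
  have hclose (t u : ℝ) := abs_le.1 (abs_rho_sub_rho_blockPart_le hT hh hl t u)
  have hδ {ε : ℝ} (hε : 0 < ε) := eventually_atTop.1
    ((tendsto_rho_blockPart hT hh hl).eventually_lt_const hε)
  refine tendsto_order.2 ⟨fun r hr => ?_, fun r hr => ?_⟩
  · obtain ⟨s₀, hs₀⟩ := hδ (half_pos (sub_pos.2 hr))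
    filter_upwards [coDirected_expCurve hT hh hl hne s₀] with t ht
    have : Nonempty (Ici s₀) := ⟨⟨s₀, self_mem_Ici⟩⟩
    rw [ht]
    refine lt_of_lt_of_le (b := L - (L - r) / 2) (by linarith) (le_ciInf fun s => ?_)
    have hL : L ≤ d (s - t) := ciInf_le (bddBelow_rho _ _ _) (s - t)
    have hs := (hclose t (s - t)).1
    rw [add_sub_cancel] at hs
    linarith [hs₀ s s.2]
  · obtain ⟨u, hu⟩ : ∃ u, d u < L + (r - L) / 2 :=
      exists_lt_of_ciInf_lt (show L < L + (r - L) / 2 by linarith)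
    obtain ⟨s₀, hs₀⟩ := hδ (half_pos (sub_pos.2 hr))
    filter_upwards [eventually_ge_atTop (s₀ - u)] with t ht
    refine (ciInf_le (bddBelow_rho _ _ _) (t + u)).trans_lt ?_
    linarith [(hclose t u).2, hs₀ (t + u) (by linarith)]

end Asymptotics

section SameDirected

variable {ι : Type*} {γ μ ν : ℝ → Matrix ι ι ℝ}

theorem SameDirected.trans (hν : SameDirected ν μ)
    (hμ : SameDirected μ γ) : SameDirected ν γ := by
  obtain ⟨a, b, ha, hν⟩ := hν
  obtain ⟨c, d, hc, hμ⟩ := hμ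
  refine ⟨c * a, c * b + d, mul_pos hc ha, fun t => ?_⟩
  rw [hν, hμ]
  ring_nf

variable [Fintype ι] [DecidableEq ι] {p : Prop} {S : Set (Matrix ι ι ℝ)}

theorem expCurve_affine (k : Matrix ι ι ℝ) (l : ι → ℝ) (a b t : ℝ) :
    expCurve k l (a * t + b) = expCurve (k * expDiag l (b / 2)) (a • l) t := by
  rw [add_comm, expCurve_add]
  simp only [expCurve, expDiag, Pi.smul_apply, smul_eq_mul, mul_assoc, mul_left_comm a]

theorem SameDirected.distTo_eq (h : SameDirected ν μ) (X : Matrix ι ι ℝ) :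
    distTo S X ν = distTo S X μ := by
  obtain ⟨a, b, ha, hν⟩ := h
  simp only [distTo, hν]
  have hsurj : Function.Surjective fun t : ℝ => a * t + b := fun y =>
    ⟨(y - b) / a, by field_simp; ring⟩
  exact hsurj.iInf_comp fun s => rho S X (μ s)

theorem SameDirected.coDirected (h : SameDirected ν μ) (hμ : CoDirected S γ μ) :
    CoDirected S γ ν := by
  intro s₀
  obtain ⟨a, b, ha, hν⟩ := id h
  filter_upwards [hμ (a * s₀ + b)] with t ht
  simp only [h.distTo_eq, ht, hν]
  have hmaps (s : Ici s₀) : a * s + b ∈ Ici (a * s₀ + b) := by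
    have hs : s₀ ≤ s := s.2
    rw [mem_Ici]
    gcongr
  have hsurj : Function.Surjective fun s : Ici s₀ => (⟨_, hmaps s⟩ : Ici (a * s₀ + b)) := by
    intro y
    have hy : a * s₀ + b ≤ y := y.2
    refine ⟨⟨(y - b) / a, ?_⟩, Subtype.ext ?_⟩
    · rw [mem_Ici, le_div_iff₀' ha]
      linarith
    · field_simp
      ring
  exact (hsurj.iInf_comp fun s => rho S (γ t) (μ s)).symm

theorem SameDirected.isGeodesic (h : SameDirected ν μ) (hμ : IsGeodesic (slice p ι) μ) :
    IsGeodesic (slice p ι) ν := by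
  obtain ⟨a, b, ha, hν⟩ := h
  obtain ⟨k, l, hk, hl, hne, rfl⟩ := isGeodesic_iff.1 hμ
  refine isGeodesic_iff.2 ⟨k * expDiag l (b / 2), a • l, hk.mul (preserves_expDiag hl _),
    fun hp => ?_, smul_ne_zero ha.ne' hne, funext fun t => (hν t).trans (expCurve_affine ..)⟩
  simp [← Finset.mul_sum, hl hp]

theorem SameDirected.mem_finitePencil (h : SameDirected ν μ)
    (hμ : μ ∈ finitePencil (slice p ι) γ) : ν ∈ finitePencil (slice p ι) γ :=
  ⟨h.isGeodesic hμ.1, h.coDirected hμ.2.1, by simpa only [h.distTo_eq] using hμ.2.2⟩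

theorem SameDirected.mem_nullPencil (h : SameDirected ν μ)
    (hμ : μ ∈ nullPencil (slice p ι) γ) : ν ∈ nullPencil (slice p ι) γ :=
  ⟨h.isGeodesic hμ.1, h.coDirected hμ.2.1, by simpa only [h.distTo_eq] using hμ.2.2⟩

end SameDirected

section Membership

variable {ι : Type*} [Fintype ι] [DecidableEq ι] {p : Prop} {h : Matrix ι ι ℝ} {l : ι → ℝ}

theorem expCurve_mem_finitePencil (hT : h.BlockTriangular (-l)) (hh : Preserves p h)
    (hl : p → ∑ i, l i = 0) (hne : l ≠ 0) :
    expCurve h l ∈ finitePencil (slice p ι) (expCurve 1 l) :=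
  ⟨isGeodesic_expCurve hh hl hne, coDirected_expCurve hT hh hl hne, _,
    tendsto_distTo_expCurve hT hh hl hne⟩

theorem distTo_self (hh : Preserves p h) (hl : p → ∑ i, l i = 0) (t : ℝ) :
    distTo (slice p ι) (expCurve h l t) (expCurve h l) = 0 :=
  le_antisymm ((ciInf_le (bddBelow_rho _ _ _) t).trans_eq (rho_self (expCurve_mem hh hl t)))
    (le_ciInf fun _ => rho_nonneg _ _ _)

theorem expCurve_mem_nullPencil (hT : h.BlockTriangular (-l)) (hh : Preserves p h)
    (hD : blockPart l h = 1) (hl : p → ∑ i, l i = 0) (hne : l ≠ 0) :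
    expCurve h l ∈ nullPencil (slice p ι) (expCurve 1 l) := by
  refine ⟨isGeodesic_expCurve hh hl hne, coDirected_expCurve hT hh hl hne, ?_⟩
  simpa only [hD, distTo_self preserves_one hl] using tendsto_distTo_expCurve hT hh hl hne

end Membership

section ExponentialGrowth

variable {ι : Type*} [Fintype ι]

theorem le_sum_sq_mul_exp (w m : ι → ℝ) (s : ℝ) (i : ι) :
    w i ^ 2 * exp (m i * s) ≤ ∑ j, w j ^ 2 * exp (m j * s) :=
  Finset.single_le_sum (f := fun j => w j ^ 2 * exp (m j * s)) (fun _ _ => by positivity)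
    (Finset.mem_univ i)

theorem sum_sq_mul_exp_le {w m : ι → ℝ} {a s : ℝ} (hm : ∀ j, w j ≠ 0 → m j ≤ a) (hs : 0 ≤ s) :
    ∑ j, w j ^ 2 * exp (m j * s) ≤ (∑ j, w j ^ 2) * exp (a * s) := by
  rw [Finset.sum_mul]
  refine Finset.sum_le_sum fun j _ => ?_
  rcases eq_or_ne (w j) 0 with hj | hj
  · simp [hj]
  · have := hm j hj
    gcongr

theorem exists_log_growth {w : ι → ℝ} (hw : w ≠ 0) (m : ι → ℝ) :
    ∃ a M : ℝ, ∀ s, 0 ≤ s → |log (∑ i, w i ^ 2 * exp (m i * s)) - a * s| ≤ M := by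
  classical
  obtain ⟨i₀, hi₀⟩ := Function.ne_iff.1 hw
  obtain ⟨i, hi, hmax⟩ := Finset.exists_max_image {i | w i ≠ 0} m ⟨i₀, by simpa using hi₀⟩
  simp only [Finset.mem_filter_univ] at hi hmax
  have hwi := sq_pos_of_ne_zero hi
  have hW : 0 < ∑ j, w j ^ 2 := hwi.trans_le (by simpa using le_sum_sq_mul_exp w m 0 i)
  refine ⟨m i, max (log (∑ j, w j ^ 2)) (-log (w i ^ 2)), fun s hs => abs_le'.2 ⟨?_, ?_⟩⟩
  · have hup := log_le_log ((by positivity : 0 < w i ^ 2 * exp (m i * s)).trans_le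
      (le_sum_sq_mul_exp w m s i)) (sum_sq_mul_exp_le hmax hs)
    rw [log_mul hW.ne' (exp_ne_zero _), log_exp] at hup
    exact le_max_of_le_left (by linarith)
  · have hlow := log_le_log (by positivity) (le_sum_sq_mul_exp w m s i)
    rw [log_mul hwi.ne' (exp_ne_zero _), log_exp] at hlow
    exact le_max_of_le_right (by linarith)

theorem div_pos_of_abs_sub_le {c b K : ℝ} (hc : c ≠ 0)
    (h : ∀ᶠ t in atTop, ∃ s ≥ 0, |c * t - b * s| ≤ K) : 0 < c / b := by
  by_contra! hcb
  have hmul : c * b ≤ 0 := mul_nonpos_iff.2 (by simpa [div_nonpos_iff] using hcb)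
  obtain ⟨t, ⟨s, hs, hK⟩, ht₀, ht⟩ :=
    (h.and ((eventually_ge_atTop 0).and (eventually_gt_atTop (K / |c|)))).exists
  have hle : |c * t| ≤ |c * t - b * s| := sq_le_sq.1 (by
    nlinarith [mul_nonneg (mul_nonneg ht₀ hs) (neg_nonneg.2 hmul), sq_nonneg (b * s)])
  rw [abs_mul, abs_of_nonneg ht₀] at hle
  rw [div_lt_iff₀' (abs_pos.2 hc)] at ht
  linarith

end ExponentialGrowth

section BoundedDistance

variable {ι : Type*} {p : Prop} {k : Matrix ι ι ℝ} {l m : ι → ℝ}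

theorem eq_comp_of_le_comp [Finite ι] {σ τ : Equiv.Perm ι} (hml : ∀ i, m i ≤ l (σ i))
    (hlm : ∀ i, l i ≤ m (τ i)) : m = l ∘ σ := by
  have := Fintype.ofFinite ι
  have hsum : ∑ i, m i = ∑ i, l (σ i) := by
    refine le_antisymm (Finset.sum_le_sum fun i _ => hml i) ?_
    rw [Equiv.sum_comp σ l, ← Equiv.sum_comp τ m]
    exact Finset.sum_le_sum fun i _ => hlm i
  exact funext fun i =>
    (Finset.sum_eq_sum_iff_of_le fun i _ => hml i).1 hsum i (Finset.mem_univ i)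

variable [Fintype ι] [DecidableEq ι]

theorem single_dotProduct_expCurve (k : Matrix ι ι ℝ) (l : ι → ℝ) (t : ℝ) (i : ι) :
    Pi.single i 1 ⬝ᵥ expCurve k l t *ᵥ Pi.single i 1 = ∑ j, k i j ^ 2 * exp (l j * t) := by
  rw [mulVec_single_one, single_one_dotProduct, col_apply, expCurve, expDiag, mul_apply]
  refine Finset.sum_congr rfl fun j _ => ?_
  rw [mul_diagonal, transpose_apply]
  ring

theorem abs_mul_sub_log_le_rho (hk : Preserves p k) (hm : p → ∑ i, m i = 0)
    (hl : p → ∑ i, l i = 0) (i : ι) (t s : ℝ) :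
    |l i * t - log (∑ j, k i j ^ 2 * exp (m j * s))| ≤
      rho (slice p ι) (expCurve 1 l t) (expCurve k m s) := by
  rw [← single_dotProduct_expCurve, ← log_dotProduct_expCurve_one]
  exact abs_log_sub_log_le_rho (expCurve_mem preserves_one hl t) (expCurve_mem hk hm s)
    (Pi.single_ne_zero_iff.2 one_ne_zero)

theorem row_ne_zero (hk : IsUnit k.det) (i : ι) : k i ≠ 0 := fun h0 =>
  hk.ne_zero (det_eq_zero_of_row_eq_zero i (congrFun h0))

theorem exists_abs_mul_sub_mul_le (hk : Preserves p k) (hm : p → ∑ i, m i = 0)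
    (hl : p → ∑ i, l i = 0) (i : ι) :
    ∃ b M : ℝ, ∀ t s, 0 ≤ s →
      |l i * t - b * s| ≤ rho (slice p ι) (expCurve 1 l t) (expCurve k m s) + M := by
  obtain ⟨b, M, hM⟩ := exists_log_growth (row_ne_zero hk.isUnit i) m
  exact ⟨b, M, fun t s hs => (abs_sub_le _ _ _).trans
    (add_le_add (abs_mul_sub_log_le_rho hk hm hl i t s) (hM s hs))⟩

theorem rho_expCurve_expCurve_le (hk : Preserves p k) (hm : p → ∑ i, m i = 0) (s t : ℝ) :
    rho (slice p ι) (expCurve k m s) (expCurve k m t) ≤ √(∑ i, m i ^ 2) * |s - t| := by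
  have hk' := hk.mul (preserves_expDiag hm (s / 2))
  have hend : expCurve (k * expDiag m (s / 2)) ((t - s) • m) 1 = expCurve k m t := by
    rw [← expCurve_affine, mul_one, sub_add_cancel]
  rw [← hend, expCurve_eq_mul_transpose k m s]
  refine (rho_expCurve_one_le hk' fun hp => ?_).trans_eq ?_
  · simp [← Finset.mul_sum, hm hp]
  · simp only [Pi.smul_apply, smul_eq_mul, mul_pow, ← Finset.mul_sum]
    rw [sqrt_mul (sq_nonneg _), sqrt_sq_eq_abs, abs_sub_comm, mul_comm]

theorem exists_bounded_rho_reparam (hk : Preserves p k) (hm : p → ∑ i, m i = 0)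
    (hl : p → ∑ i, l i = 0) (hne : l ≠ 0) {C : ℝ}
    (hC : ∀ᶠ t in atTop, ∃ s ≥ 0, rho (slice p ι) (expCurve 1 l t) (expCurve k m s) ≤ C) :
    ∃ a > 0, ∃ C', ∀ᶠ t in atTop,
      rho (slice p ι) (expCurve 1 l t) (expCurve k m (a * t)) ≤ C' := by
  obtain ⟨i, hi⟩ := Function.ne_iff.1 hne
  obtain ⟨b, M, hM⟩ := exists_abs_mul_sub_mul_le hk hm hl i
  have ha : 0 < l i / b := div_pos_of_abs_sub_le (K := C + M) hi (hC.mono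
    fun t ⟨s, hs, hst⟩ => ⟨s, hs, (hM t s hs).trans (add_le_add_left hst M)⟩)
  have hb : b ≠ 0 := by
    rintro rfl
    simp at ha
  refine ⟨l i / b, ha, C + √(∑ i, m i ^ 2) * ((C + M) / |b|), hC.mono fun t ⟨s, hs, hst⟩ => ?_⟩
  have hclose : |s - l i / b * t| ≤ (C + M) / |b| := by
    rw [abs_sub_comm, le_div_iff₀' (abs_pos.2 hb), ← abs_mul, mul_sub, ← mul_assoc,
      mul_div_cancel₀ _ hb]
    exact (hM t s hs).trans (add_le_add_left hst M)
  have hν := expCurve_mem hk hm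
  calc _ ≤ _ := rho_triangle (expCurve_mem preserves_one hl t) (hν s) (hν (l i / b * t))
    _ ≤ _ := add_le_add hst ((rho_expCurve_expCurve_le hk hm _ _).trans (by gcongr))

theorem le_of_bounded_rho (hk : Preserves p k) (hm : p → ∑ i, m i = 0) (hl : p → ∑ i, l i = 0)
    {C : ℝ} (hC : ∀ᶠ t in atTop, rho (slice p ι) (expCurve 1 l t) (expCurve k m t) ≤ C)
    {i j : ι} (hij : k i j ≠ 0) : m j ≤ l i := by
  by_contra! hlt
  obtain ⟨t, ht, htC⟩ :=
    (hC.and (eventually_gt_atTop ((C - log (k i j ^ 2)) / (m j - l i)))).exists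
  have hlip := (abs_mul_sub_log_le_rho hk hm hl i t t).trans ht
  have hlow := log_le_log (by positivity) (le_sum_sq_mul_exp (k i) m t j)
  rw [log_mul (by positivity) (exp_ne_zero _), log_exp] at hlow
  rw [div_lt_iff₀ (sub_pos.2 hlt)] at htC
  linarith [(abs_le.1 hlip).1]

theorem exists_perm_ne_zero (hk : k.det ≠ 0) : ∃ σ : Equiv.Perm ι, ∀ i, k (σ i) i ≠ 0 := by
  rw [det_apply] at hk
  obtain ⟨σ, -, hσ⟩ := Finset.exists_ne_zero_of_sum_ne_zero hk
  refine ⟨σ, fun i h0 => hσ ?_⟩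
  rw [Finset.prod_eq_zero (f := fun j => k (σ j) j) (Finset.mem_univ i) h0, smul_zero]

theorem expCurve_comp_perm (k : Matrix ι ι ℝ) (l : ι → ℝ) (σ : Equiv.Perm ι) :
    expCurve k (l ∘ σ) = expCurve (k.submatrix id σ.symm) l := by
  funext t
  ext i j
  simp only [expCurve, expDiag, mul_apply (N := _ᵀ), mul_diagonal, submatrix_apply, id,
    transpose_apply]
  exact Fintype.sum_equiv σ _ _ fun x => by simp

theorem exists_blockTriangular_of_bounded_rho (hk : Preserves p k) (hm : p → ∑ i, m i = 0)
    (hl : p → ∑ i, l i = 0) {C : ℝ}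
    (hC : ∀ᶠ t in atTop, rho (slice p ι) (expCurve 1 l t) (expCurve k m t) ≤ C) :
    ∃ h : Matrix ι ι ℝ, Preserves p h ∧ h.BlockTriangular (-l) ∧ expCurve k m = expCurve h l := by
  have hC' : ∀ᶠ t in atTop, rho (slice p ι) (expCurve 1 m t) (expCurve k⁻¹ l t) ≤ C :=
    hC.mono fun t ht => by
      have hγ := expCurve_mem (preserves_one (p := p)) hl t
      rw [rho_comm (expCurve_mem preserves_one hm t) (expCurve_mem hk.inv hl t)]
      rw [← rho_congr hk.inv hγ (expCurve_mem hk hm t), ← expCurve_mul, ← expCurve_mul,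
        Matrix.mul_one, nonsing_inv_mul _ hk.isUnit] at ht
      exact ht
  have hle {i j : ι} : k i j ≠ 0 → m j ≤ l i := le_of_bounded_rho hk hm hl hC
  -- nonzero terms of `det k` and `det k⁻¹` give permutations with `m ≤ l ∘ σ` and `l ≤ m ∘ τ`
  obtain ⟨σ, hσ⟩ := exists_perm_ne_zero hk.isUnit.ne_zero
  obtain ⟨τ, hτ⟩ := exists_perm_ne_zero hk.inv.isUnit.ne_zero
  obtain rfl : m = l ∘ σ := eq_comp_of_le_comp (fun i => hle (hσ i))
    fun i => le_of_bounded_rho hk.inv hl hm hC' (hτ i)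
  have hcurve := expCurve_comp_perm k l σ
  refine ⟨k.submatrix id σ.symm, ?_, fun i j hij => ?_, hcurve⟩
  · refine preserves_of_mul_transpose_mem ?_
    rw [← expCurve_zero _ l, ← hcurve]
    exact expCurve_mem hk hm 0
  · by_contra h0
    have := hle h0
    rw [Function.comp_apply, Equiv.apply_symm_apply] at this
    exact (neg_lt_neg_iff.1 hij).not_ge this

theorem exists_blockTriangular_of_mem_finitePencil {ν : ℝ → Matrix ι ι ℝ}
    (hl : p → ∑ i, l i = 0) (hne : l ≠ 0)
    (hν : ν ∈ finitePencil (slice p ι) (expCurve 1 l)) :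
    ∃ h : Matrix ι ι ℝ, Preserves p h ∧ h.BlockTriangular (-l) ∧
      SameDirected ν (expCurve h l) := by
  obtain ⟨hg, hdir, L, hL⟩ := hν
  obtain ⟨k, m, hk, hm, -, rfl⟩ := isGeodesic_iff.1 hg
  have hbdd : ∀ᶠ t in atTop, ∃ s ≥ 0,
      rho (slice p ι) (expCurve 1 l t) (expCurve k m s) ≤ L + 1 := by
    filter_upwards [hdir 0, hL.eventually_lt_const (lt_add_one L)] with t ht hlt
    rw [ht] at hlt
    have : Nonempty (Ici (0 : ℝ)) := ⟨⟨0, self_mem_Ici⟩⟩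
    obtain ⟨s, hs⟩ := exists_lt_of_ciInf_lt hlt
    exact ⟨s, s.2, hs.le⟩
  obtain ⟨a, ha, C, hC⟩ := exists_bounded_rho_reparam hk hm hl hne hbdd
  have haff (t : ℝ) : expCurve k m (a * t) = expCurve k (a • m) t := by
    simpa [expDiag_zero] using expCurve_affine k m a 0 t
  simp only [haff] at hC
  obtain ⟨h, hh, hT, heq⟩ := exists_blockTriangular_of_bounded_rho hk
    (fun hp => by simp [← Finset.mul_sum, hm hp]) hl hC
  refine ⟨h, hh, hT, a⁻¹, 0, inv_pos.2 ha, fun t => ?_⟩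
  rw [← heq, ← haff, add_zero, mul_inv_cancel_left₀ ha.ne']

theorem finitePencil_eq (hl : p → ∑ i, l i = 0) (hne : l ≠ 0) :
    finitePencil (slice p ι) (expCurve 1 l) =
      {ν | ∃ h : Matrix ι ι ℝ, Preserves p h ∧ h.BlockTriangular (-l) ∧
        SameDirected ν (expCurve h l)} :=
  ext fun _ => ⟨exists_blockTriangular_of_mem_finitePencil hl hne, fun ⟨_, hh, hT, hν⟩ =>
    hν.mem_finitePencil (expCurve_mem_finitePencil hT hh hl hne)⟩

end BoundedDistance

section NullPencil

variable {ι : Type*} [Fintype ι] [DecidableEq ι] {p : Prop} {X h k : Matrix ι ι ℝ} {l : ι → ℝ}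

theorem continuous_rho_expCurve (hX : X ∈ slice p ι) (hk : Preserves p k)
    (hl : p → ∑ i, l i = 0) : Continuous fun s => rho (slice p ι) X (expCurve k l s) := by
  have hmem := expCurve_mem hk hl
  refine (LipschitzWith.of_le_add_mul' (√(∑ i, l i ^ 2)) fun s t => ?_).continuous
  have hst := rho_expCurve_expCurve_le hk hl t s
  rw [dist_comm, Real.dist_eq]
  linarith [rho_triangle hX (hmem t) (hmem s)]

theorem tendsto_rho_expCurve_cocompact (hX : X ∈ slice p ι) (hk : Preserves p k)
    (hl : p → ∑ i, l i = 0) (hne : l ≠ 0) :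
    Tendsto (fun s => rho (slice p ι) X (expCurve k l s)) (cocompact ℝ) atTop := by
  obtain ⟨i, hi⟩ := Function.ne_iff.1 hne
  have hmem := expCurve_mem hk hl
  refine tendsto_atTop_mono (fun s => ?_) (tendsto_atTop_add_const_right _
    (-rho (slice p ι) X (expCurve k l 0))
    ((tendsto_norm_cocompact_atTop (E := ℝ)).const_mul_atTop (abs_pos.2 hi)))
  have hlow := le_rho_expCurve hk hl i s 0
  have htri := rho_triangle (hmem s) hX (hmem 0)
  rw [sub_zero, ← Real.norm_eq_abs s] at hlow
  rw [rho_comm (hmem s) hX] at htri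
  linarith

theorem exists_expCurve_eq_of_distTo_eq_zero (hX : X ∈ slice p ι) (hk : Preserves p k)
    (hl : p → ∑ i, l i = 0) (hne : l ≠ 0) (h0 : distTo (slice p ι) X (expCurve k l) = 0) :
    ∃ s, expCurve k l s = X := by
  obtain ⟨s, hs⟩ := (continuous_rho_expCurve hX hk hl).exists_forall_le
    (tendsto_rho_expCurve_cocompact hX hk hl hne)
  refine ⟨s, (eq_of_rho_eq_zero hX (expCurve_mem hk hl s) ?_).symm⟩
  exact le_antisymm ((le_ciInf hs).trans_eq h0) (rho_nonneg _ _ _)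

theorem sameDirected_mul_inv_blockPart (hT : h.BlockTriangular (-l)) (hh : IsUnit h.det) {s : ℝ}
    (hs : expCurve (blockPart l h) l s = expCurve 1 l 0) :
    SameDirected (expCurve h l) (expCurve (h * (blockPart l h)⁻¹) l) := by
  refine ⟨1, -s, one_pos, fun t => ?_⟩
  have hblock : expCurve (blockPart l h) l t = expCurve 1 l (t - s) := by
    rw [← sub_add_cancel t s, expCurve_add_of_commute (commute_blockPart l h), hs,
      ← expCurve_add_of_commute fun _ => Commute.one_left _, add_zero, sub_add_cancel]
  have hmul : h * (blockPart l h)⁻¹ * blockPart l h = h :=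
    nonsing_inv_mul_cancel_right _ _ (det_blockPart hT ▸ hh)
  rw [one_mul, ← sub_eq_add_neg]
  calc expCurve h l t = expCurve (h * (blockPart l h)⁻¹ * blockPart l h) l t := by rw [hmul]
    _ = expCurve (h * (blockPart l h)⁻¹ * 1) l (t - s) := by
      rw [expCurve_mul, hblock, ← expCurve_mul]
    _ = expCurve (h * (blockPart l h)⁻¹) l (t - s) := by rw [Matrix.mul_one]

theorem exists_blockPart_eq_one_of_mem_nullPencil {ν : ℝ → Matrix ι ι ℝ}
    (hl : p → ∑ i, l i = 0) (hne : l ≠ 0) (hν : ν ∈ nullPencil (slice p ι) (expCurve 1 l)) :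
    ∃ h : Matrix ι ι ℝ, h.BlockTriangular (-l) ∧ blockPart l h = 1 ∧
      SameDirected ν (expCurve h l) := by
  obtain ⟨hg, hdir, h0⟩ := hν
  obtain ⟨h, hh, hT, hν⟩ := exists_blockTriangular_of_mem_finitePencil hl hne ⟨hg, hdir, 0, h0⟩
  have hD := preserves_of_det_eq hh (det_blockPart hT)
  simp only [hν.distTo_eq] at h0
  obtain ⟨s, hs⟩ := exists_expCurve_eq_of_distTo_eq_zero (expCurve_mem preserves_one hl 0) hD hl
    hne (tendsto_nhds_unique (tendsto_distTo_expCurve hT hh hl hne) h0)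
  exact ⟨_, blockTriangular_mul_inv_blockPart hT hh.isUnit,
    blockPart_mul_inv_blockPart hT hh.isUnit,
    hν.trans (sameDirected_mul_inv_blockPart hT hh.isUnit hs)⟩

theorem preserves_of_blockPart_eq_one (hT : h.BlockTriangular (-l)) (h1 : blockPart l h = 1) :
    Preserves p h :=
  preserves_of_det_eq preserves_one (by rw [← det_blockPart hT, h1])

theorem nullPencil_eq (hl : p → ∑ i, l i = 0) (hne : l ≠ 0) :
    nullPencil (slice p ι) (expCurve 1 l) =
      {ν | ∃ h : Matrix ι ι ℝ, h.BlockTriangular (-l) ∧ blockPart l h = 1 ∧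
        SameDirected ν (expCurve h l)} :=
  ext fun _ => ⟨exists_blockPart_eq_one_of_mem_nullPencil hl hne, fun ⟨_, hT, h1, hν⟩ =>
    hν.mem_nullPencil (expCurve_mem_nullPencil hT (preserves_of_blockPart_eq_one hT h1) h1 hl hne)⟩

end NullPencil

section Projective

variable {ι : Type*} [Fintype ι]

/-- `l` minus its mean. Up to scalar factors, `exp(t · diag l)` does not change if `l` is
replaced by it. -/
noncomputable def centered (l : ι → ℝ) (i : ι) : ℝ :=
  l i - (∑ j, l j) / Fintype.card ι

theorem centered_lt_centered {l : ι → ℝ} {i j : ι} : centered l i < centered l j ↔ l i < l j :=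
  sub_lt_sub_iff_right _

theorem centered_inj {l : ι → ℝ} {i j : ι} : centered l i = centered l j ↔ l i = l j :=
  sub_left_inj

theorem blockTriangular_neg_centered {l : ι → ℝ} {h : Matrix ι ι ℝ} :
    h.BlockTriangular (-centered l) ↔ h.BlockTriangular (-l) := by
  simp only [BlockTriangular, Pi.neg_apply, neg_lt_neg_iff, centered_lt_centered]

theorem blockPart_centered (l : ι → ℝ) : blockPart (centered l) = blockPart l := by
  funext h
  simp only [blockPart, centered_inj]

theorem expCurve_smul_centered [DecidableEq ι] (h : Matrix ι ι ℝ) (l : ι → ℝ) (r t : ℝ) :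
    r ^ 2 • expCurve h l t =
      exp ((∑ j, l j) / Fintype.card ι * t) • expCurve (r • h) (centered l) t := by
  have hexp : expDiag l t =
      exp ((∑ j, l j) / Fintype.card ι * t) • expDiag (centered l) t := by
    rw [expDiag, expDiag, ← diagonal_smul]
    congr 1
    funext i
    rw [Pi.smul_apply, smul_eq_mul, ← exp_add, centered]
    ring_nf
  simp only [expCurve, hexp, transpose_smul, Matrix.mul_smul, Matrix.smul_mul, smul_smul]
  congr 1
  ring

variable [Nonempty ι]

theorem sum_centered (l : ι → ℝ) : ∑ i, centered l i = 0 := by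
  simp only [centered, Finset.sum_sub_distrib, Finset.sum_const, Finset.card_univ, nsmul_eq_mul]
  rw [mul_div_cancel₀ _ (Nat.cast_ne_zero.2 Fintype.card_ne_zero), sub_self]

variable [DecidableEq ι] {h : Matrix ι ι ℝ} {l : ι → ℝ}

theorem toPEE_smul {X : Matrix ι ι ℝ} (hX : X.det = 1) {a : ℝ} (ha : 0 < a) :
    toPEE (a • X) = X := by
  have hn : (Fintype.card ι : ℝ) ≠ 0 := Nat.cast_ne_zero.2 Fintype.card_ne_zero
  rw [toPEE, det_smul, hX, mul_one, smul_smul, ← rpow_natCast, ← rpow_mul ha.le, mul_neg,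
    mul_one_div_cancel hn, rpow_neg_one, inv_mul_cancel₀ ha.ne', one_smul]

theorem toPEE_expCurve {r : ℝ} (hr : r ≠ 0) (hh : Preserves True (r • h)) :
    (fun t => toPEE (expCurve h l t)) = expCurve (r • h) (centered l) := by
  funext t
  have hmem := expCurve_mem hh (fun _ => sum_centered l) t
  have hcurve : expCurve h l t = ((r ^ 2)⁻¹ * exp ((∑ j, l j) / Fintype.card ι * t)) •
      expCurve (r • h) (centered l) t := by
    rw [mul_smul, ← expCurve_smul_centered, inv_smul_smul₀ (pow_ne_zero 2 hr)]
  rw [hcurve, toPEE_smul (hmem.2 trivial) (by positivity)]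

theorem toPEE_expCurve_of_preserves (hh : Preserves True h) :
    (fun t => toPEE (expCurve h l t)) = expCurve h (centered l) := by
  simpa only [one_smul] using
    toPEE_expCurve (l := l) one_ne_zero (show Preserves True ((1 : ℝ) • h) by rwa [one_smul])

theorem exists_preserves_smul (hh : IsUnit h.det) : ∃ r : ℝ, r ≠ 0 ∧ Preserves True (r • h) := by
  have hn : (Fintype.card ι : ℝ) ≠ 0 := Nat.cast_ne_zero.2 Fintype.card_ne_zero
  have hdet : 0 < |h.det| := abs_pos.2 hh.ne_zero
  set r := |h.det| ^ (-(1 / (Fintype.card ι : ℝ))) with hr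
  have hpow : r ^ Fintype.card ι = |h.det|⁻¹ := by
    rw [hr, ← rpow_natCast, ← rpow_mul hdet.le, neg_mul, one_div_mul_cancel hn, rpow_neg_one]
  have hsq : (r • h).det ^ 2 = 1 := by
    rw [det_smul, hpow, mul_pow, inv_pow, sq_abs, inv_mul_cancel₀ (pow_ne_zero 2 hh.ne_zero)]
  have hunit : IsUnit (r • h).det := IsUnit.of_pow_eq_one hsq two_ne_zero
  exact ⟨r, (rpow_pos_of_pos hdet _).ne', hunit, fun _ => hsq⟩

end Projective

section Pencils

variable {ι : Type*} [Fintype ι] [DecidableEq ι] {l : ι → ℝ}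

theorem finitePencil_EE (hne : l ≠ 0) :
    finitePencil (EE ι) (expCurve 1 l) =
      {ν | ∃ h : Matrix ι ι ℝ, (IsUnit h.det ∧ h.BlockTriangular (-l)) ∧
        SameDirected ν (expCurve h l)} := by
  have hp {h : Matrix ι ι ℝ} : Preserves False h ↔ IsUnit h.det :=
    ⟨Preserves.isUnit, fun hh => ⟨hh, False.elim⟩⟩
  simp only [EE_eq_slice, finitePencil_eq False.elim hne, hp, and_assoc]

theorem nullPencil_EE (hne : l ≠ 0) :
    nullPencil (EE ι) (expCurve 1 l) =
      {ν | ∃ h : Matrix ι ι ℝ, (h.BlockTriangular (-l) ∧ blockPart l h = 1) ∧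
        SameDirected ν (expCurve h l)} := by
  simp only [EE_eq_slice, nullPencil_eq False.elim hne, and_assoc]

variable [Nonempty ι]

theorem finitePencil_PEE (hne : centered l ≠ 0) :
    finitePencil (PEE ι) (fun t => toPEE (expCurve 1 l t)) =
      {ν | ∃ h : Matrix ι ι ℝ, (IsUnit h.det ∧ h.BlockTriangular (-l)) ∧
        SameDirected ν fun t => toPEE (expCurve h l t)} := by
  rw [toPEE_expCurve_of_preserves preserves_one, PEE_eq_slice,
    finitePencil_eq (fun _ => sum_centered l) hne]
  ext ν
  constructor
  · rintro ⟨h, hh, hT, hν⟩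
    rw [blockTriangular_neg_centered] at hT
    exact ⟨h, ⟨hh.isUnit, hT⟩, by rwa [toPEE_expCurve_of_preserves hh]⟩
  · rintro ⟨h, ⟨hh, hT⟩, hν⟩
    obtain ⟨r, hr, hrh⟩ := exists_preserves_smul hh
    rw [toPEE_expCurve hr hrh] at hν
    refine ⟨r • h, hrh, fun i j hij => ?_, hν⟩
    rw [Matrix.smul_apply, blockTriangular_neg_centered.2 hT hij, smul_zero]

theorem nullPencil_PEE (hne : centered l ≠ 0) :
    nullPencil (PEE ι) (fun t => toPEE (expCurve 1 l t)) =
      {ν | ∃ h : Matrix ι ι ℝ, (h.BlockTriangular (-l) ∧ blockPart l h = 1) ∧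
        SameDirected ν fun t => toPEE (expCurve h l t)} := by
  rw [toPEE_expCurve_of_preserves preserves_one, PEE_eq_slice,
    nullPencil_eq (fun _ => sum_centered l) hne]
  simp only [blockTriangular_neg_centered, blockPart_centered, ← and_assoc]
  refine Set.ext fun ν => exists_congr fun h => and_congr_right fun ⟨hT, h1⟩ => ?_
  rw [toPEE_expCurve_of_preserves (preserves_of_blockPart_eq_one hT h1)]

end Pencils

section Blocks

variable {n : ℕ} {α : Fin n → ℕ} {ψ : Fin n → ℝ}

theorem mul_gam_mul_transpose (h : Matrix (Idx α) (Idx α) ℝ) (t : ℝ) :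
    h * gam α ψ t * hᵀ = expCurve h (fun i => ψ i.1) t := rfl

theorem gam_eq_expCurve : gam α ψ = expCurve 1 fun i => ψ i.1 :=
  funext fun t => by rw [← mul_gam_mul_transpose, Matrix.one_mul, transpose_one, Matrix.mul_one]

theorem blockTri_eq (hψ : StrictAnti ψ) :
    blockTri α = {h | IsUnit h.det ∧ h.BlockTriangular (-fun i => ψ i.1)} := by
  simp only [blockTri, BlockTriangular, Pi.neg_apply, neg_lt_neg_iff, hψ.lt_iff_gt]

theorem blockPart_eq_one_iff (hψ : StrictAnti ψ) {h : Matrix (Idx α) (Idx α) ℝ} :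
    blockPart (fun i => ψ i.1) h = 1 ↔ ∀ k, h.blockDiag' k = 1 := by
  refine ⟨fun h1 k => ?_, fun h1 => ?_⟩
  · ext i j
    simpa [blockPart, blockDiag'_apply, one_apply] using congrFun₂ h1 ⟨k, i⟩ ⟨k, j⟩
  · ext ⟨k, i⟩ ⟨k', j⟩
    rcases eq_or_ne k k' with rfl | hk
    · simpa [blockPart, blockDiag'_apply, one_apply] using congrFun₂ (h1 k) i j
    · simp [blockPart, hψ.injective.ne hk, hk]

theorem blockUni_eq (hψ : StrictAnti ψ) :
    blockUni α = {h | h.BlockTriangular (-fun i => ψ i.1) ∧ blockPart (fun i => ψ i.1) h = 1} := by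
  simp only [blockUni, BlockTriangular, Pi.neg_apply, neg_lt_neg_iff, hψ.lt_iff_gt,
    blockPart_eq_one_iff hψ]

end Blocks

end SymPencil

theorem theorem3p3 {m : ℕ} (α : Fin m → ℕ) (hα : ∀ k, 0 < α k)
    (ψ : Fin m → ℝ) (hψ : StrictAnti ψ) :
    -- the pencils in `𝔼`, when `γ` is not constant there
    ((∃ k, ψ k ≠ 0) →
      finitePencil (EE (Idx α)) (gam α ψ) =
          {ν | ∃ h ∈ blockTri α, SameDirected ν fun t => h * gam α ψ t * hᵀ} ∧
        nullPencil (EE (Idx α)) (gam α ψ) =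
          {ν | ∃ h ∈ blockUni α, SameDirected ν fun t => h * gam α ψ t * hᵀ}) ∧
    -- the pencils in `ℙ𝔼`, when `γ` is not constant there
    (1 < m →
      finitePencil (PEE (Idx α)) (fun t => toPEE (gam α ψ t)) =
          {ν | ∃ h ∈ blockTri α, SameDirected ν fun t => toPEE (h * gam α ψ t * hᵀ)} ∧
        nullPencil (PEE (Idx α)) (fun t => toPEE (gam α ψ t)) =
          {ν | ∃ h ∈ blockUni α, SameDirected ν fun t => toPEE (h * gam α ψ t * hᵀ)}) := by
  simp only [mul_gam_mul_transpose, blockTri_eq hψ, blockUni_eq hψ]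
  rw [gam_eq_expCurve]
  refine ⟨fun ⟨k, hk⟩ => ?_, fun hm => ?_⟩
  · have hne : (fun i : Idx α => ψ i.1) ≠ 0 := fun h0 => hk (congrFun h0 ⟨k, 0, hα k⟩)
    exact ⟨finitePencil_EE hne, nullPencil_EE hne⟩
  · let i : Idx α := ⟨⟨0, by lia⟩, 0, hα _⟩
    let j : Idx α := ⟨⟨1, hm⟩, 0, hα _⟩
    have : Nonempty (Idx α) := ⟨i⟩
    have hij : centered (fun i : Idx α => ψ i.1) j < centered (fun i : Idx α => ψ i.1) i :=
      centered_lt_centered.2 (hψ (show i.1 < j.1 from Nat.one_pos))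
    have hne : centered (fun i : Idx α => ψ i.1) ≠ 0 := fun h0 => by simp [h0] at hij
    exact ⟨finitePencil_PEE hne, nullPencil_PEE hne⟩
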